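/- Let $d,m,k\ge 1$ be integers. For a complex matrix $A$ let $\|A\|_1$ be its trace norm (the sum of its singular values). Let $\mathcal L:\mathbb C^{d\times d}\to\mathbb C^{k\times k}$ be a nonzero linear map (a superoperator), let $\mathcal I_d$ be the identity map on $\mathbb C^{d\times d}$ and $I_d$ the identity matrix, and put $\Psi_d=\sum_{i,j=1}^d |ii\rangle\langle jj|$ and $\Phi_d=\frac1d\Psi_d$. Define $$\|\mathcal L\|_{\mathrm{ACID}}=\|(\mathcal L\otimes\mathcal I_d)\Phi_d\|_1,\qquad \|\mathcal L\|_\diamond=\max_{\|X\|_1=1}\|(\mathcal L\otimes\mathcal I_d)X\|_1,$$ where $X$ ranges over $\mathbb C^{d\times d}\otimes\mathbb C^{d\times d}$, and, for a density matrix $\rho\in\mathbb C^{d\times d}$, $$\|\mathcal L\|_\rho=\big\|(\mathcal L\otimes\mathcal I_d)\big((\sqrt\rho\otimes I_d)\Psi_d(\sqrt\rho\otimes I_d)\big)\big\|_1 .$$ Let $|\boldsymbol\psi\rangle$ be a Haar random unit vector in $\mathbb C^d\otimes\mathbb C^m$ (i.e. uniformly distributed on the unit sphere), and let $\boldsymbol\rho$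 be the partial trace of $|\boldsymbol\psi\rangle\langle\boldsymbol\psi|$ over the second register $\mathbb C^m$. Then $\|\mathcal L\|_{\boldsymbol\rho}$ is integrable, and for all real $t\ge 0$, $$\Pr\Big[\big|\|\mathcal L\|_{\boldsymbol\rho}-\mathbb E\|\mathcal L\|_{\boldsymbol\rho}\big|\ge t\,\|\mathcal L\|_{\mathrm{ACID}}\Big]\le\exp\Big(\pi-\frac{d\,m\,t^2\,\|\mathcal L\|_{\mathrm{ACID}}^2}{8\,\|\mathcal L\|_\diamond^2}\Big)\le\exp\Big(\pi-\frac{m\,t^2}{8d}\Big).$$ -/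

import Mathlib

open MeasureTheory ProbabilityTheory
open scoped Matrix Kronecker MatrixOrder

noncomputable section

namespace AcidNorm

/-- The trace norm (Schatten 1-norm) of a complex matrix: the sum of its singular values. -/
def traceNorm {a b : Type*} [Fintype a] [Fintype b] [DecidableEq b] (A : Matrix a b ℂ) : ℝ :=
  ∑ i ∈ Finset.range (Fintype.card b), (Matrix.toEuclideanLin A).singularValues i

/-- A superoperator `ℂ^{n × n} → ℂ^{k × k}`: a linear map between spaces of square matrices,
with no positivity, trace or Hermiticity condition. -/
abbrev Superoperator (n k : ℕ) : Type :=
  Matrix (Fin n) (Fin n) ℂ →ₗ[ℂ] Matrix (Fin k) (Fin k) ℂ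

/-- The superoperator `L ⊗ I_r`. Matrices in `ℂ^{n × n} ⊗ ℂ^{r × r}` are indexed by pairs, and
`L` is applied to each block `(X_{(i,s),(j,t)})_{i,j}` (for fixed `s, t`), so that
`(L ⊗ I_r) (A ⊗ B) = L A ⊗ B`. -/
def ampliation {n k : ℕ} (r : ℕ) (L : Superoperator n k) :
    Matrix (Fin n × Fin r) (Fin n × Fin r) ℂ →ₗ[ℂ] Matrix (Fin k × Fin r) (Fin k × Fin r) ℂ where
  toFun X := Matrix.of fun p q => L (Matrix.of fun i j => X (i, p.2) (j, q.2)) p.1 q.1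
  map_add' X Y := by
    ext p q
    exact congrFun (congrFun (L.map_add (Matrix.of fun i j => X (i, p.2) (j, q.2))
      (Matrix.of fun i j => Y (i, p.2) (j, q.2))) p.1) q.1
  map_smul' c X := by
    ext p q
    exact congrFun (congrFun (L.map_smul c (Matrix.of fun i j => X (i, p.2) (j, q.2))) p.1) q.1

/-- The defining property of `L ⊗ I_r`. -/
theorem ampliation_kronecker {n k : ℕ} (r : ℕ) (L : Superoperator n k)
    (A : Matrix (Fin n) (Fin n) ℂ) (B : Matrix (Fin r) (Fin r) ℂ) :
    ampliation r L (A ⊗ₖ B) = L A ⊗ₖ B := by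
  ext p q
  have h : (Matrix.of fun i j => (A ⊗ₖ B) (i, p.2) (j, q.2)) = B p.2 q.2 • A := by
    ext i j
    simp [Matrix.kroneckerMap_apply, mul_comm]
  change L (Matrix.of fun i j => (A ⊗ₖ B) (i, p.2) (j, q.2)) p.1 q.1 = _
  rw [h, map_smul]
  simp [Matrix.kroneckerMap_apply, mul_comm]

/-- The unnormalized maximally entangled operator `Ψ_d = ∑_{i,j} |ii⟩⟨jj|`. -/
def unnormMaxEnt (d : ℕ) : Matrix (Fin d × Fin d) (Fin d × Fin d) ℂ :=
  Matrix.of fun p q => if p.1 = p.2 ∧ q.1 = q.2 then 1 else 0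

/-- The maximally entangled state `Φ_d = (1/d) ∑_{i,j} |ii⟩⟨jj|`. -/
def maxEnt (d : ℕ) : Matrix (Fin d × Fin d) (Fin d × Fin d) ℂ :=
  (d : ℂ)⁻¹ • unnormMaxEnt d

/-- The ACID norm of `L`: the trace norm of its Choi operator `(L ⊗ I_d) Φ_d`. -/
def acidNorm {d k : ℕ} (L : Superoperator d k) : ℝ :=
  traceNorm (ampliation d L (maxEnt d))

/-- The diamond norm of `L`: the maximum of `‖(L ⊗ I_d) X‖₁` over all `X` with `‖X‖₁ = 1`. -/
def diamondNorm {d k : ℕ} (L : Superoperator d k) : ℝ :=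
  sSup {r : ℝ | ∃ X : Matrix (Fin d × Fin d) (Fin d × Fin d) ℂ,
    traceNorm X = 1 ∧ r = traceNorm (ampliation d L X)}

/-- The `ρ` norm `‖L‖_ρ = ‖(L ⊗ I_d) ((√ρ ⊗ I_d) Ψ_d (√ρ ⊗ I_d))‖₁`, where `√ρ` is the positive
semidefinite square root of `ρ`. -/
def rhoNorm {d k : ℕ} (ρ : Matrix (Fin d) (Fin d) ℂ) (L : Superoperator d k) : ℝ :=
  traceNorm (ampliation d L
    ((CFC.sqrt ρ ⊗ₖ (1 : Matrix (Fin d) (Fin d) ℂ)) * unnormMaxEnt d *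
      (CFC.sqrt ρ ⊗ₖ (1 : Matrix (Fin d) (Fin d) ℂ))))

/-- State vectors: unit vectors of the Hilbert space `ℂ^d ⊗ ℂ^m`. -/
abbrev StateVector (d m : ℕ) : Type :=
  Metric.sphere (0 : EuclideanSpace ℂ (Fin d × Fin m)) 1

/-- The law of a Haar random state vector: the uniform probability measure on the unit sphere of
`ℂ^d ⊗ ℂ^m ≅ ℝ^{2dm}`, i.e. the surface measure divided by its total mass. -/
def haarState (d m : ℕ) : Measure (StateVector d m) :=
  ((volume : Measure (EuclideanSpace ℂ (Fin d × Fin m))).toSphere Set.univ)⁻¹ •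
    (volume : Measure (EuclideanSpace ℂ (Fin d × Fin m))).toSphere

/-- The rank-one density matrix `|ψ⟩⟨ψ|`. -/
def pureState {d m : ℕ} (ψ : StateVector d m) : Matrix (Fin d × Fin m) (Fin d × Fin m) ℂ :=
  Matrix.of fun p q => ψ.1 p * star (ψ.1 q)

/-- The partial trace over the second register. -/
def partialTrace {d m : ℕ} (X : Matrix (Fin d × Fin m) (Fin d × Fin m) ℂ) :
    Matrix (Fin d) (Fin d) ℂ :=
  Matrix.of fun i j => ∑ s, X (i, s) (j, s)

/-- The reduction of the state `|ψ⟩⟨ψ|` to the first register. -/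
def reducedState {d m : ℕ} (ψ : StateVector d m) : Matrix (Fin d) (Fin d) ℂ :=
  partialTrace (pureState ψ)

end AcidNorm

end

namespace AcidNorm

open Set Filter Topology

/-! ### Monotone transport on the line -/

/-! The theorem is Lévy's lemma for the function `ψ ↦ ‖L‖_ρ(ψ)` on the unit sphere of real dimension
`n = 2dm`, combined with the Lipschitz constant `K = 2‖L‖_⋄`.

Lipschitz bound. Write `ψ` as a `d × m` matrix `M`, so that `ρ = M Mᴴ` and `M = √ρ V` for a
contraction `V`. Vectorization turns `(√ρ ⊗ 1) Ψ (√ρ ⊗ 1)` into the rank-one operator of `vec √ρ`.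
For two states with roots `S` and `R`, an Uhlmann-type argument gives a contraction `U` with `‖vec S
- vec (R U)‖ ≤ ‖ψ - φ‖`. Right multiplication by `U` acts on the second register only, so it
commutes with `L ⊗ I` and cannot raise the trace norm. The remaining difference of rank-one
operators costs `2‖L‖_⋄ ‖ψ - φ‖`. The same commutation, started from `Ψ`, gives `‖L‖_⋄ ≤ d
‖L‖_ACID`, hence the second inequality.

Lévy's lemma, in the form `exp (π - n s² / (4 K²))`. Monotone transport proves the quadratic
transport-entropy inequality for the Gaussian on the line; it tensorizes and yields the exponential
moment bound for Lipschitz functions of a Gaussian vector. A function on the sphere is made constant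
along rays outside the ball of radius `√(n/2)` and extended inside with constant `K / √(n/2)`. The
Gaussian vector rarely falls in this ball, so moments pass from Gaussian space to the sphere with an
explicit constant factor, which `e^π` absorbs. -/

theorem hasDerivAt_integral_Iic {a : ℝ → ℝ} (ha : Continuous a) (hai : Integrable a) (x : ℝ) :
    HasDerivAt (fun x => ∫ t in Iic x, a t) (a x) x := by
  have h1 : (fun x => ∫ t in Iic x, a t) = fun x => (∫ t in (0 : ℝ)..x, a t) + ∫ t in Iic 0, a t := by
    funext y
    rw [← intervalIntegral.integral_Iic_sub_Iic hai.integrableOn hai.integrableOn]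
    ring
  rw [h1]
  exact (intervalIntegral.integral_hasDerivAt_right (ha.intervalIntegrable _ _)
    (ha.stronglyMeasurableAtFilter _ _) ha.continuousAt).add_const _

theorem strictMono_integral_Iic {a : ℝ → ℝ} (ha : Continuous a) (ha0 : ∀ x, 0 < a x)
    (hai : Integrable a) : StrictMono (fun x => ∫ t in Iic x, a t) :=
  strictMono_of_hasDerivAt_pos (hasDerivAt_integral_Iic ha hai) ha0

theorem tendsto_integral_Iic_atTop {a : ℝ → ℝ} (hai : Integrable a) :
    Tendsto (fun x => ∫ t in Iic x, a t) atTop (𝓝 (∫ t, a t)) := by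
  have h := tendsto_setIntegral_of_monotone (μ := volume) (f := a) (s := fun x : ℝ => Iic x)
    (fun i => measurableSet_Iic) (fun i j h => Iic_subset_Iic.2 h) hai.integrableOn
  have hu : (⋃ n : ℝ, Iic n) = univ := by
    ext x; simp only [mem_iUnion, mem_Iic, mem_univ, iff_true]; exact ⟨x, le_rfl⟩
  rwa [hu, setIntegral_univ] at h

theorem exists_integral_Iic_eq {a b : ℝ → ℝ} (ha : Continuous a) (hb : Continuous b)
    (ha0 : ∀ x, 0 < a x) (hai : Integrable a) (hbi : Integrable b)
    (hab : ∫ t, a t = ∫ t, b t) (x : ℝ) :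
    ∃ y, ∫ t in Iic x, a t = ∫ t in Iic y, b t := by
  have hmono := strictMono_integral_Iic ha ha0 hai
  have hlo : 0 < ∫ t in Iic x, a t := by
    have h := tendsto_integral_Iic_zero (f := a) (μ := volume) tendsto_id
    have h2 : (0 : ℝ) ≤ ∫ t in Iic (x - 1), a t :=
      setIntegral_nonneg measurableSet_Iic fun t _ => (ha0 t).le
    exact h2.trans_lt (hmono (by linarith))
  have hhi : ∫ t in Iic x, a t < ∫ t, b t := by
    rw [← hab]
    exact (hmono (show x < x + 1 by linarith)).trans_le
      (setIntegral_le_integral hai (Eventually.of_forall fun t => (ha0 t).le))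
  have hcont : Continuous (fun x => ∫ t in Iic x, b t) :=
    continuous_iff_continuousAt.2 fun y => (hasDerivAt_integral_Iic hb hbi y).continuousAt
  obtain ⟨y1, hy1⟩ := ((tendsto_integral_Iic_zero (f := b) (μ := volume)
    tendsto_id).eventually (gt_mem_nhds hlo)).exists
  obtain ⟨y2, hy2⟩ := ((tendsto_integral_Iic_atTop hbi).eventually (lt_mem_nhds hhi)).exists
  obtain ⟨y, hy⟩ := mem_range_of_exists_le_of_exists_ge hcont ⟨y1, le_of_lt hy1⟩ ⟨y2, hy2.le⟩
  exact ⟨y, hy.symm⟩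

/-- The increasing rearrangement between two positive continuous densities of the same mass. -/
theorem exists_monotone_transport {a b : ℝ → ℝ} (ha : Continuous a) (hb : Continuous b)
    (ha0 : ∀ x, 0 < a x) (hb0 : ∀ x, 0 < b x) (hai : Integrable a) (hbi : Integrable b)
    (hab : ∫ t, a t = ∫ t, b t) :
    ∃ T : ℝ → ℝ, Monotone T ∧ (∀ x, ∫ t in Iic x, a t = ∫ t in Iic (T x), b t) ∧
      ∀ x, HasDerivAt T (a x / b (T x)) x := by
  choose T hT using exists_integral_Iic_eq ha hb ha0 hai hbi hab
  choose S hS using exists_integral_Iic_eq hb ha hb0 hbi hai hab.symm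
  have hA := strictMono_integral_Iic ha ha0 hai
  have hB := strictMono_integral_Iic hb hb0 hbi
  have hmono : Monotone T := fun x y hxy => by
    refine hB.le_iff_le.1 ?_
    simp only [← hT]
    exact hA.monotone hxy
  have hsurj : Function.Surjective T := fun y => ⟨S y, hB.injective (by
    simp only [← hT, hS])⟩
  -- Continuity keeps `T y` near `T x`, where `T` is the local inverse of the second distribution
  -- function composed with the first. The inverse function theorem then gives the derivative.
  have hcont : Continuous T := hmono.continuous_of_surjective hsurj
  refine ⟨T, hmono, hT, fun x => ?_⟩
  have hstrict : HasStrictDerivAt (fun x => ∫ t in Iic x, b t) (b (T x)) (T x) :=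
    hasStrictDerivAt_of_hasDerivAt_of_continuousAt
      (Eventually.of_forall fun y => hasDerivAt_integral_Iic hb hbi y) hb.continuousAt
  have hne := (hb0 (T x)).ne'
  have hloc := hstrict.eventually_left_inverse hne
  have hder := (hstrict.to_localInverse hne).hasDerivAt
  have h1 : T =ᶠ[𝓝 x] fun y => (hstrict.localInverse _ _ _ hne) (∫ t in Iic y, a t) := by
    filter_upwards [hcont.continuousAt.eventually hloc] with y hy
    rw [hT y, hy]
  rw [← hT x] at hder
  have h2 := (hder.comp x (hasDerivAt_integral_Iic ha hai x)).congr_of_eventuallyEq h1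
  exact h2.congr_deriv (div_eq_inv_mul _ _).symm

/-! ### The standard Gaussian density on the line -/

local notation "φ" => gaussianPDFReal 0 1

theorem gaussianPDFReal_std (x : ℝ) :
    gaussianPDFReal 0 1 x = (√(2 * Real.pi))⁻¹ * Real.exp (-x ^ 2 / 2) := by
  simp [gaussianPDFReal]

theorem continuous_gaussianPDFReal_std : Continuous φ := by
  rw [show φ = _ from funext gaussianPDFReal_std]
  fun_prop

theorem hasDerivAt_gaussianPDFReal_std (x : ℝ) : HasDerivAt φ (-x * φ x) x := by
  rw [show φ = _ from funext gaussianPDFReal_std]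
  have h : HasDerivAt (fun x : ℝ => -x ^ 2 / 2) (-x) x := by
    have := ((hasDerivAt_pow 2 x).neg).div_const 2
    refine this.congr_deriv ?_
    push_cast
    ring
  refine (h.exp.const_mul _).congr_deriv ?_
  ring

theorem integral_gaussianReal_std (f : ℝ → ℝ) :
    ∫ x, f x ∂(gaussianReal 0 1) = ∫ x, f x * φ x := by
  rw [integral_gaussianReal_eq_integral_smul one_ne_zero]
  simp [mul_comm]

/-- Chebyshev's bound from the unit second moment; polynomial decay suffices for the boundary terms
below. -/
theorem sq_mul_integral_Ioi_gaussianPDFReal_le {t : ℝ} (ht : 0 ≤ t) :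
    t ^ 2 * ∫ x in Ioi t, φ x ≤ 1 := by
  have hsq : ∫ x, x ^ 2 * φ x = 1 := by
    have := variance_fun_id_gaussianReal (μ := 0) (v := 1)
    rw [variance_eq_integral (by fun_prop)] at this
    simpa [integral_gaussianReal_std] using this
  have hint : Integrable (fun x => x ^ 2 * φ x) := by
    by_contra h
    rw [integral_undef h] at hsq
    exact zero_ne_one hsq
  calc t ^ 2 * ∫ x in Ioi t, φ x = ∫ x in Ioi t, t ^ 2 * φ x := (integral_const_mul _ _).symm
    _ ≤ ∫ x in Ioi t, x ^ 2 * φ x := by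
        refine setIntegral_mono_on ((integrable_gaussianPDFReal 0 1).const_mul _).integrableOn
          hint.integrableOn measurableSet_Ioi fun x hx => ?_
        have hx' : t < x := hx
        have := gaussianPDFReal_nonneg 0 1 x
        gcongr
    _ ≤ ∫ x, x ^ 2 * φ x := setIntegral_le_integral hint (Eventually.of_forall fun x =>
        mul_nonneg (sq_nonneg x) (gaussianPDFReal_nonneg 0 1 x))
    _ = 1 := hsq

theorem le_integral_Ioi_gaussianPDFReal {r : ℝ} (hr : 0 ≤ r) :
    φ (r + 1) ≤ ∫ x in Ioi r, φ x := by
  have hc := continuous_gaussianPDFReal_std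
  calc φ (r + 1) = ∫ x in r..(r + 1), φ (r + 1) := by simp
    _ ≤ ∫ x in r..(r + 1), φ x := by
        refine intervalIntegral.integral_mono_on (by linarith) (by simp)
          (hc.intervalIntegrable _ _) fun x hx => ?_
        rw [gaussianPDFReal_std, gaussianPDFReal_std]
        have := hx.1
        have := hx.2
        gcongr
        linarith
    _ = ∫ x in Ioc r (r + 1), φ x := intervalIntegral.integral_of_le (by linarith)
    _ ≤ ∫ x in Ioi r, φ x := setIntegral_mono_set (integrable_gaussianPDFReal 0 1).integrableOn
        (Eventually.of_forall fun x => gaussianPDFReal_nonneg 0 1 x)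
        (Ioc_subset_Ioi_self).eventuallyLE

/-- If the Gaussian tails at `T r` dominate those at `r` up to a constant, then `T` grows slowly
compared with the Gaussian density. -/
theorem tendsto_boundary_term {T : ℝ → ℝ} {C : ℝ}
    (hT : ∀ r, 0 ≤ r → ∫ x in Ioi r, φ x ≤ C * ∫ x in Ioi (T r), φ x) :
    Tendsto (fun r => max (T r) 0 * φ r) atTop (𝓝 0) := by
  have hC : 0 ≤ C := by
    by_contra hC
    have h1 := hT 0 le_rfl
    have h2 := le_integral_Ioi_gaussianPDFReal (le_refl (0 : ℝ))
    have h3 := gaussianPDFReal_pos 0 1 (0 + 1) one_ne_zero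
    have h4 : 0 ≤ ∫ x in Ioi (T 0), φ x := setIntegral_nonneg measurableSet_Ioi
      fun x _ => gaussianPDFReal_nonneg 0 1 x
    nlinarith
  set D : ℝ := √(2 * Real.pi) with hD
  have hDpos : 0 < D := by positivity
  have hsq : ∀ r, 0 ≤ r → (max (T r) 0 * φ r) ^ 2 ≤ C * D⁻¹ * Real.exp (-(r ^ 2 / 2 - r - 1 / 2)) := by
    intro r hr
    rcases le_total (T r) 0 with h | h
    · rw [max_eq_right h]
      have : 0 ≤ C * D⁻¹ * Real.exp (-(r ^ 2 / 2 - r - 1 / 2)) := by positivity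
      simpa using this
    · rw [max_eq_left h]
      have h1 := (le_integral_Ioi_gaussianPDFReal hr).trans (hT r hr)
      have h2 := sq_mul_integral_Ioi_gaussianPDFReal_le h
      -- The tail beyond `r` is at least `φ (r + 1)`, and the tail beyond `T r` at most `1 / (T
      -- r)²`.
      have h3 : T r ^ 2 * φ (r + 1) ≤ C := by
        nlinarith [mul_le_mul_of_nonneg_left h1 (sq_nonneg (T r)),
          mul_le_mul_of_nonneg_left h2 hC]
      -- Squaring `φ r` beats the loss caused by the shift to `r + 1`.
      have h4 : φ r ^ 2 = φ (r + 1) * (D⁻¹ * Real.exp (-(r ^ 2 / 2 - r - 1 / 2))) := by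
        rw [gaussianPDFReal_std, gaussianPDFReal_std, mul_pow, ← Real.exp_nat_mul]
        rw [show D⁻¹ * Real.exp (-(r + 1) ^ 2 / 2) * (D⁻¹ * Real.exp (-(r ^ 2 / 2 - r - 1 / 2))) =
          D⁻¹ ^ 2 * (Real.exp (-(r + 1) ^ 2 / 2) * Real.exp (-(r ^ 2 / 2 - r - 1 / 2))) by ring,
          ← Real.exp_add]
        congr 2
        push_cast
        ring
      calc (T r * φ r) ^ 2 = T r ^ 2 * φ (r + 1) * (D⁻¹ * Real.exp (-(r ^ 2 / 2 - r - 1 / 2))) := by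
            rw [mul_pow, h4]; ring
        _ ≤ C * (D⁻¹ * Real.exp (-(r ^ 2 / 2 - r - 1 / 2))) := by gcongr
        _ = _ := by ring
  have hlim : Tendsto (fun r : ℝ => C * D⁻¹ * Real.exp (-(r ^ 2 / 2 - r - 1 / 2))) atTop (𝓝 0) := by
    have h1 : Tendsto (fun r : ℝ => r ^ 2 / 2 - r - 1 / 2) atTop atTop := by
      refine tendsto_atTop_mono' _ ?_ tendsto_id
      filter_upwards [eventually_ge_atTop (5 : ℝ)] with r hr
      simp only [id]
      nlinarith
    simpa using (Real.tendsto_exp_neg_atTop_nhds_zero.comp h1).const_mul (C * D⁻¹)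
  have hsq0 : Tendsto (fun r => (max (T r) 0 * φ r) ^ 2) atTop (𝓝 0) := by
    refine squeeze_zero' (Eventually.of_forall fun r => sq_nonneg _) ?_ hlim
    filter_upwards [eventually_ge_atTop (0 : ℝ)] with r hr using hsq r hr
  have := hsq0.sqrt
  rw [Real.sqrt_zero] at this
  refine this.congr fun r => Real.sqrt_sq ?_
  exact mul_nonneg (le_max_right _ _) (gaussianPDFReal_nonneg 0 1 r)

/-- The quadratic transport-entropy inequality for the Gaussian measure on the line, in dual
(infimum-convolution) form. -/
theorem log_integral_exp_gaussianReal_le {f g : ℝ → ℝ} {M : ℝ} (hf : Continuous f)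
    (hg : Continuous g) (hfM : ∀ x, |f x| ≤ M) (hgM : ∀ x, |g x| ≤ M)
    (hfg : ∀ x y, g x ≤ f y + (x - y) ^ 2 / 2) :
    Real.log (∫ x, Real.exp (g x) ∂(gaussianReal 0 1)) ≤ ∫ x, f x ∂(gaussianReal 0 1) := by
  have hφ := continuous_gaussianPDFReal_std
  have hφ0 : ∀ x, 0 < φ x := fun x => gaussianPDFReal_pos 0 1 x one_ne_zero
  have hφi : Integrable φ := integrable_gaussianPDFReal 0 1
  have hφ1 : ∫ x, φ x = 1 := integral_gaussianPDFReal_eq_one 0 one_ne_zero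
  have hexpi : Integrable (fun x => Real.exp (g x) * φ x) := by
    refine hφi.bdd_mul (c := Real.exp M) (by fun_prop) (Eventually.of_forall fun x => ?_)
    rw [Real.norm_eq_abs, Real.abs_exp]
    exact Real.exp_le_exp.2 ((abs_le.1 (hgM x)).2)
  have hfi : Integrable (fun x => f x * φ x) := by
    refine hφi.bdd_mul (c := M) (by fun_prop) (Eventually.of_forall fun x => ?_)
    exact hfM x
  rw [integral_gaussianReal_std, integral_gaussianReal_std]
  set Z : ℝ := ∫ x, Real.exp (g x) * φ x with hZ
  have hZ0 : 0 < Z := by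
    refine (integral_pos_iff_support_of_nonneg
      (fun x => (mul_pos (Real.exp_pos _) (hφ0 x)).le) hexpi).2 ?_
    rw [show Function.support (fun x => Real.exp (g x) * φ x) = univ from
      eq_univ_of_forall fun x => (mul_pos (Real.exp_pos _) (hφ0 x)).ne']
    simp
  -- `T` pushes the Gaussian to the tilted probability density `e^g φ / Z`.
  obtain ⟨T, -, hT, hTd⟩ := exists_monotone_transport (b := fun x => Real.exp (g x) * φ x / Z)
    hφ (by fun_prop) hφ0 (fun x => div_pos (mul_pos (Real.exp_pos _) (hφ0 x)) hZ0) hφi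
    (hexpi.div_const Z) (by rw [hφ1, integral_div, div_self hZ0.ne'])
  have hbi := hexpi.div_const Z
  have hb1 : ∫ x, Real.exp (g x) * φ x / Z = 1 := by rw [integral_div, div_self hZ0.ne']
  have hble : ∀ x, Real.exp (g x) * φ x / Z ≤ Real.exp M / Z * φ x := fun x => by
    rw [mul_div_right_comm]
    have := (hφ0 x).le
    gcongr
    exact (abs_le.1 (hgM x)).2
  have htail1 : Tendsto (fun r => max (T r) 0 * φ r) atTop (𝓝 0) := by
    refine tendsto_boundary_term (C := Real.exp M / Z) fun r _ => ?_
    have h1 := intervalIntegral.integral_Iic_add_Ioi (b := r) hφi.integrableOn hφi.integrableOn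
    have h2 := intervalIntegral.integral_Iic_add_Ioi (b := T r) hbi.integrableOn hbi.integrableOn
    rw [hφ1] at h1
    rw [hb1] at h2
    calc ∫ x in Ioi r, φ x = ∫ x in Ioi (T r), Real.exp (g x) * φ x / Z := by linarith [hT r]
      _ ≤ ∫ x in Ioi (T r), Real.exp M / Z * φ x :=
        integral_mono hbi.integrableOn (hφi.const_mul _).integrableOn hble
      _ = _ := integral_const_mul _ _
  have htail2 : Tendsto (fun r => max (-T (-r)) 0 * φ r) atTop (𝓝 0) := by
    have heven : ∀ t, ∫ x in Iic (-t), φ x = ∫ x in Ioi t, φ x := fun t => by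
      rw [← integral_comp_neg_Ioi]
      simp [gaussianPDFReal_std]
    refine tendsto_boundary_term (T := fun r => -T (-r)) (C := Real.exp M / Z) fun r _ => ?_
    rw [← heven, ← heven, hT, neg_neg]
    calc ∫ x in Iic (T (-r)), Real.exp (g x) * φ x / Z
        ≤ ∫ x in Iic (T (-r)), Real.exp M / Z * φ x :=
        integral_mono hbi.integrableOn (hφi.const_mul _).integrableOn hble
      _ = _ := integral_const_mul _ _
  have hint : Integrable (fun x => (Real.log Z - f x) * φ x) := by
    simp only [sub_mul]
    exact (hφi.const_mul _).sub hfi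
  have hTcont : Continuous T := continuous_iff_continuousAt.2 fun x => (hTd x).continuousAt
  have hH : ∀ x, HasDerivAt (fun x => (T x - x) * φ x)
      ((φ x / (Real.exp (g (T x)) * φ (T x) / Z) - 1) * φ x + (T x - x) * (-x * φ x)) x := fun x =>
    ((hTd x).sub (hasDerivAt_id x)).mul (hasDerivAt_gaussianPDFReal_std x)
  -- By `log T' ≤ T' - 1` and `g (T x) ≤ f x + (T x - x)² / 2`, one has `log Z - f x ≤ T' - 1 - x (T
  -- x - x)`. Times `φ`, the right side is the exact derivative of `(T x - x) φ x`, since `φ' = -x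
  -- φ`; only vanishing boundary terms remain after integration.
  have hle : ∀ x, (Real.log Z - f x) * φ x ≤
      (φ x / (Real.exp (g (T x)) * φ (T x) / Z) - 1) * φ x + (T x - x) * (-x * φ x) := fun x => by
    have h1 : φ x / (Real.exp (g (T x)) * φ (T x) / Z) =
        Real.exp (Real.log Z - g (T x) + T x ^ 2 / 2 - x ^ 2 / 2) := by
      rw [gaussianPDFReal_std, gaussianPDFReal_std,
        show Real.log Z - g (T x) + T x ^ 2 / 2 - x ^ 2 / 2 =
          (Real.log Z + (-x ^ 2 / 2)) - (g (T x) + (-T x ^ 2 / 2)) by ring,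
        Real.exp_sub, Real.exp_add, Real.exp_add, Real.exp_log hZ0]
      have : √(2 * Real.pi) ≠ 0 := by positivity
      field_simp
    have h2 := Real.add_one_le_exp (Real.log Z - g (T x) + T x ^ 2 / 2 - x ^ 2 / 2)
    rw [← h1] at h2
    have h3 := hfg (T x) x
    have h4 : Real.log Z - f x ≤ φ x / (Real.exp (g (T x)) * φ (T x) / Z) - 1 - x * (T x - x) := by
      nlinarith
    have := mul_le_mul_of_nonneg_right h4 (hφ0 x).le
    linarith
  have hbound : ∀ᶠ r : ℝ in atTop, ∫ x in (-r)..r, (Real.log Z - f x) * φ x ≤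
      max (T r) 0 * φ r + max (-T (-r)) 0 * φ r := by
    filter_upwards [eventually_ge_atTop (0 : ℝ)] with r hr
    have h := intervalIntegral.integral_le_sub_of_hasDeriv_right_of_le
      (g := fun x => (T x - x) * φ x) (a := -r) (b := r) (by linarith)
      (by fun_prop) (fun x _ => (hH x).hasDerivWithinAt)
      hint.integrableOn (fun x _ => hle x)
    refine h.trans ?_
    have heven : φ (-r) = φ r := by simp [gaussianPDFReal_std]
    rw [heven]
    have h1 := mul_le_mul_of_nonneg_right (le_max_left (T r) 0) (hφ0 r).le
    have h2 := mul_le_mul_of_nonneg_right (le_max_left (-T (-r)) 0) (hφ0 r).le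
    have h3 := mul_nonneg hr (hφ0 r).le
    nlinarith
  have hlim := intervalIntegral_tendsto_integral hint tendsto_neg_atTop_atBot tendsto_id
  have hfin := le_of_tendsto_of_tendsto hlim (htail1.add htail2) hbound
  simp only [sub_mul] at hfin
  rw [integral_sub (hφi.const_mul _) hfi, integral_const_mul, hφ1] at hfin
  linarith

end AcidNorm

namespace AcidNorm

open Set Filter Topology

/-! ### Tensorization of the transport-entropy inequality -/

/-- The transport-entropy inequality with cost `c`, in dual form. -/
def TransportEntropy {X : Type*} [TopologicalSpace X] [MeasurableSpace X] (μ : Measure X)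
    (c : X → X → ℝ) : Prop :=
  ∀ (f g : X → ℝ) (M : ℝ), Continuous f → Continuous g → (∀ x, |f x| ≤ M) → (∀ x, |g x| ≤ M) →
    (∀ x y, g x ≤ f y + c x y) → Real.log (∫ x, Real.exp (g x) ∂μ) ≤ ∫ x, f x ∂μ

theorem transportEntropy_gaussianReal :
    TransportEntropy (gaussianReal 0 1) (fun x y => (x - y) ^ 2 / 2) :=
  fun _ _ _ hf hg hfM hgM hfg => log_integral_exp_gaussianReal_le hf hg hfM hgM hfg

theorem continuous_integral_left {X Y : Type*} [TopologicalSpace X] [SecondCountableTopology X]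
    [MeasurableSpace X] [OpensMeasurableSpace X] [TopologicalSpace Y] [FirstCountableTopology Y]
    {μ : Measure X} [IsFiniteMeasure μ] {h : X × Y → ℝ} {M : ℝ}
    (hh : Continuous h) (hM : ∀ z, |h z| ≤ M) : Continuous fun y => ∫ x, h (x, y) ∂μ := by
  refine continuous_of_dominated (bound := fun _ => M) (fun y => ?_) (fun y => ?_)
    (integrable_const M) ?_
  · exact (by fun_prop : Continuous fun x => h (x, y)).measurable.aestronglyMeasurable
  · exact Eventually.of_forall fun x => hM _
  · exact Eventually.of_forall fun x => by fun_prop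

theorem integrable_of_continuous_of_abs_le {X : Type*} [TopologicalSpace X] [MeasurableSpace X]
    [OpensMeasurableSpace X] {μ : Measure X} [IsFiniteMeasure μ] {h : X → ℝ} {M : ℝ}
    (hh : Continuous h) (hM : ∀ z, |h z| ≤ M) : Integrable h μ :=
  Integrable.of_bound hh.measurable.aestronglyMeasurable M (Eventually.of_forall hM)

theorem abs_integral_le_of_abs_le {X : Type*} [MeasurableSpace X] {μ : Measure X}
    [IsProbabilityMeasure μ] {h : X → ℝ} {M : ℝ} (hM : ∀ z, |h z| ≤ M) : |∫ x, h x ∂μ| ≤ M := by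
  have := norm_integral_le_of_norm_le_const (μ := μ) (f := h) (C := M) (Eventually.of_forall hM)
  simpa using this

theorem TransportEntropy.prod {X Y : Type*} [TopologicalSpace X] [SecondCountableTopology X]
    [MeasurableSpace X] [BorelSpace X] [TopologicalSpace Y] [SecondCountableTopology Y]
    [MeasurableSpace Y] [BorelSpace Y] {μ : Measure X} {ν : Measure Y} [IsProbabilityMeasure μ]
    [IsProbabilityMeasure ν] {c : X → X → ℝ} {c' : Y → Y → ℝ} (hμ : TransportEntropy μ c)
    (hν : TransportEntropy ν c') :
    TransportEntropy (μ.prod ν) (fun p q => c p.1 q.1 + c' p.2 q.2) := by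
  intro f g M hf hg hfM hgM hfg
  have hexpM : ∀ z, |Real.exp (g z)| ≤ Real.exp M := fun z => by
    rw [Real.abs_exp]
    exact Real.exp_le_exp.2 (abs_le.1 (hgM z)).2
  have hexpc : Continuous fun z => Real.exp (g z) := by fun_prop
  have hi : ∀ y, Integrable (fun x => Real.exp (g (x, y))) μ := fun y =>
    integrable_of_continuous_of_abs_le (by fun_prop) fun x => hexpM (x, y)
  have hlow : ∀ y, Real.exp (-M) ≤ ∫ x, Real.exp (g (x, y)) ∂μ := fun y => by
    have := integral_mono (integrable_const (Real.exp (-M))) (hi y) fun x =>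
      Real.exp_le_exp.2 (abs_le.1 (hgM (x, y))).1
    simpa using this
  have hpos : ∀ y, 0 < ∫ x, Real.exp (g (x, y)) ∂μ := fun y => (Real.exp_pos _).trans_le (hlow y)
  have hupp : ∀ y, ∫ x, Real.exp (g (x, y)) ∂μ ≤ Real.exp M := fun y =>
    (le_abs_self _).trans (abs_integral_le_of_abs_le fun x => hexpM (x, y))
  -- The mean of `f` and the log-moment of `g` over the first variable are again admissible for
  -- `c'`: for fixed `y, y'` this is the inequality for `μ` with the constant `c' y y'` added to
  -- `f`.
  have key := hν (fun y => ∫ x, f (x, y) ∂μ) (fun y => Real.log (∫ x, Real.exp (g (x, y)) ∂μ)) M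
    (continuous_integral_left hf hfM)
    ((continuous_integral_left hexpc hexpM).log fun y => (hpos y).ne')
    (fun y => abs_integral_le_of_abs_le fun x => hfM (x, y))
    (fun y => abs_le.2 ⟨(Real.le_log_iff_exp_le (hpos y)).2 (hlow y),
      (Real.log_le_iff_le_exp (hpos y)).2 (hupp y)⟩)
    (fun y y' => by
      have h := hμ (fun x => f (x, y') + c' y y') (fun x => g (x, y)) (M + |c' y y'|)
        (by fun_prop) (by fun_prop)
        (fun x => (abs_add_le _ _).trans (by gcongr; exact hfM _))
        (fun x => (hgM _).trans (by linarith [abs_nonneg (c' y y')]))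
        (fun x x' => by have := hfg (x, y) (x', y'); simp only at this; linarith)
      have hfi : Integrable (fun x => f (x, y')) μ :=
        integrable_of_continuous_of_abs_le (by fun_prop) fun x => hfM (x, y')
      rw [integral_add hfi (integrable_const _)] at h
      simpa using h)
  simp only [Real.exp_log (hpos _)] at key
  rwa [integral_prod_symm _ (integrable_of_continuous_of_abs_le hexpc hexpM),
    integral_prod_symm _ (integrable_of_continuous_of_abs_le hf hfM)]

theorem transportEntropy_pi_gaussianReal (n : ℕ) :
    TransportEntropy (Measure.pi fun _ : Fin n => gaussianReal 0 1)
      (fun x y => ∑ i, (x i - y i) ^ 2 / 2) := by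
  induction n with
  | zero =>
    intro f g M _ _ _ _ hfg
    rw [Measure.pi_of_empty _ (fun i => i.elim0)]
    simpa using hfg (fun i => i.elim0) (fun i => i.elim0)
  | succ n ih =>
    intro f g M hf hg hfM hgM hfg
    have hmp := (measurePreserving_piFinSuccAbove (fun _ : Fin (n + 1) => gaussianReal 0 1) 0).symm
    have h := (transportEntropy_gaussianReal.prod ih) (fun p => f (Fin.cons p.1 p.2))
      (fun p => g (Fin.cons p.1 p.2)) M (by fun_prop) (by fun_prop) (fun p => hfM _)
      (fun p => hgM _) (fun p q => by
        have := hfg (Fin.cons p.1 p.2) (Fin.cons q.1 q.2)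
        simpa [Fin.sum_univ_succ] using this)
    have h1 := hmp.integral_comp' (g := f)
    have h2 := hmp.integral_comp' (g := fun x => Real.exp (g x))
    rw [← h1, ← h2]
    simpa [MeasurableEquiv.piFinSuccAbove, Fin.insertNthEquiv] using h

/-! ### Concentration of Lipschitz functions of a Gaussian vector -/

variable {E : Type*} [NormedAddCommGroup E] [InnerProductSpace ℝ E] [FiniteDimensional ℝ E]
  [MeasurableSpace E] [BorelSpace E]

theorem integral_exp_lipschitz_stdGaussian_le {F : E → ℝ} {K : NNReal} {M : ℝ}
    (hF : LipschitzWith K F) (hM : ∀ x, |F x| ≤ M) {l : ℝ} (hl : 0 ≤ l) :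
    ∫ x, Real.exp (l * F x) ∂(stdGaussian E) ≤
      Real.exp (l * ∫ x, F x ∂(stdGaussian E) + l ^ 2 * K ^ 2 / 2) := by
  set b := stdOrthonormalBasis ℝ E with hb
  set Φ : (Fin (Module.finrank ℝ E) → ℝ) → E := fun x => ∑ i, x i • b i with hΦ
  have hstd : stdGaussian E = (Measure.pi fun _ => gaussianReal 0 1).map Φ := rfl
  have hΦc : Continuous Φ := by fun_prop
  have hdist : ∀ x y, ‖Φ x - Φ y‖ ^ 2 = ∑ i, (x i - y i) ^ 2 := fun x y => by
    have h1 : Φ x - Φ y = b.repr.symm (WithLp.toLp 2 (x - y)) := by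
      rw [hΦ, ← OrthonormalBasis.sum_repr_symm]
      simp [sub_smul]
    rw [h1, LinearIsometryEquiv.norm_map, EuclideanSpace.norm_sq_eq]
    simp
  have hFc := hF.continuous
  have hlM : ∀ x, |l * F (Φ x)| ≤ l * M := fun x => by
    rw [abs_mul, abs_of_nonneg hl]
    exact mul_le_mul_of_nonneg_left (hM _) hl
  -- The pair is admissible because `l K r ≤ r² / 2 + l² K² / 2`.
  have key := transportEntropy_pi_gaussianReal (Module.finrank ℝ E) (fun x => l * F (Φ x))
    (fun x => l * F (Φ x) - l ^ 2 * K ^ 2 / 2) (l * M + l ^ 2 * K ^ 2 / 2)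
    (by fun_prop) (by fun_prop) (fun x => (hlM x).trans (by nlinarith [sq_nonneg (l * K)]))
    (fun x => (abs_sub _ _).trans (by
      rw [abs_of_nonneg (by positivity : 0 ≤ l ^ 2 * (K : ℝ) ^ 2 / 2)]
      gcongr
      exact hlM x))
    (fun x y => by
      have h1 := (le_abs_self _).trans (hF.dist_le_mul (Φ x) (Φ y))
      rw [dist_eq_norm] at h1
      have h2 := hdist x y
      beta_reduce
      rw [← Finset.sum_div, ← h2]
      nlinarith [mul_le_mul_of_nonneg_left h1 hl, sq_nonneg (l * K - ‖Φ x - Φ y‖)])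
  have hint : Integrable (fun x => Real.exp (l * F (Φ x)))
      (Measure.pi fun _ : Fin (Module.finrank ℝ E) => gaussianReal 0 1) :=
    integrable_of_continuous_of_abs_le (M := Real.exp (l * M)) (by fun_prop) fun x => by
      rw [Real.abs_exp]
      exact Real.exp_le_exp.2 (abs_le.1 (hlM x)).2
  rw [hstd, integral_map hΦc.aemeasurable (by fun_prop),
    integral_map hΦc.aemeasurable (by fun_prop)]
  simp only [Real.exp_sub, div_eq_mul_inv] at key
  rw [integral_mul_const, integral_const_mul, Real.log_mul (integral_exp_pos hint).ne'
    (by positivity), Real.log_inv, Real.log_exp] at key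
  rw [← Real.log_le_iff_le_exp (integral_exp_pos hint)]
  linarith

end AcidNorm

namespace AcidNorm

open Set Filter Topology

/-! ### Density and polar decomposition of the standard Gaussian measure -/

section GaussianDensity

variable {E : Type*} [NormedAddCommGroup E] [InnerProductSpace ℝ E] [FiniteDimensional ℝ E]
  [MeasurableSpace E] [BorelSpace E]

theorem integral_exp_neg_half_norm_sq :
    ∫ x : E, Real.exp (-‖x‖ ^ 2 / 2) = (2 * Real.pi) ^ (Module.finrank ℝ E / 2 : ℝ) := by
  have h := GaussianFourier.integral_rexp_neg_mul_sq_norm (V := E) (b := 1 / 2) (by norm_num)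
  rw [show Real.pi / (1 / 2) = 2 * Real.pi by ring] at h
  rw [← h]
  congr with x
  ring_nf

theorem integrable_exp_neg_half_norm_sq : Integrable (fun x : E => Real.exp (-‖x‖ ^ 2 / 2)) := by
  by_contra h
  have h1 := integral_exp_neg_half_norm_sq (E := E)
  rw [integral_undef h] at h1
  have : 0 < (2 * Real.pi) ^ (Module.finrank ℝ E / 2 : ℝ) := by positivity
  exact this.ne h1

/-- Both sides are finite measures with the same characteristic function. The density is what polar
coordinates require. -/
theorem stdGaussian_eq_withDensity :
    stdGaussian E = (volume : Measure E).withDensity fun x => ENNReal.ofReal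
      (((2 * Real.pi) ^ (Module.finrank ℝ E / 2 : ℝ))⁻¹ * Real.exp (-‖x‖ ^ 2 / 2)) := by
  set c : ℝ := ((2 * Real.pi) ^ (Module.finrank ℝ E / 2 : ℝ))⁻¹ with hc
  have hc0 : 0 ≤ c := by positivity
  have hint := (integrable_exp_neg_half_norm_sq (E := E)).const_mul c
  have : IsFiniteMeasure ((volume : Measure E).withDensity fun x => ENNReal.ofReal
      (c * Real.exp (-‖x‖ ^ 2 / 2))) := isFiniteMeasure_withDensity_ofReal hint.2
  refine Measure.ext_of_charFun (funext fun t => ?_)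
  rw [charFun_stdGaussian, charFun_apply, integral_withDensity_eq_integral_toReal_smul
    (by fun_prop) (Eventually.of_forall fun x => ENNReal.ofReal_lt_top)]
  have h := GaussianFourier.integral_cexp_neg_mul_sq_norm_add (V := E) (b := 1 / 2) (by norm_num)
    Complex.I t
  have h1 : ∀ x : E, (ENNReal.ofReal (c * Real.exp (-‖x‖ ^ 2 / 2))).toReal •
      Complex.exp (inner ℝ x t * Complex.I) =
      (c : ℂ) * Complex.exp (-(1 / 2) * ‖x‖ ^ 2 + Complex.I * inner ℝ t x) := fun x => by
    rw [ENNReal.toReal_ofReal (by positivity), Complex.real_smul, Complex.ofReal_mul,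
      Complex.ofReal_exp, mul_assoc, ← Complex.exp_add, real_inner_comm]
    congr 2
    push_cast
    ring
  simp only [h1]
  rw [integral_const_mul, h]
  have h2 : ((Real.pi : ℂ) / (1 / 2)) ^ (Module.finrank ℝ E / 2 : ℂ) =
      (((2 * Real.pi) ^ (Module.finrank ℝ E / 2 : ℝ) : ℝ) : ℂ) := by
    rw [Complex.ofReal_cpow (by positivity)]
    push_cast
    congr 1
    ring
  have h3 : ((2 * Real.pi) ^ (Module.finrank ℝ E / 2 : ℝ) : ℝ) ≠ 0 := by positivity
  rw [h2, hc, ← mul_assoc, ← Complex.ofReal_mul, inv_mul_cancel₀ h3, Complex.ofReal_one, one_mul]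
  rw [Complex.I_sq]
  congr 1
  ring

theorem integral_stdGaussian (f : E → ℝ) :
    ∫ x, f x ∂(stdGaussian E) = ∫ x, f x *
      (((2 * Real.pi) ^ (Module.finrank ℝ E / 2 : ℝ))⁻¹ * Real.exp (-‖x‖ ^ 2 / 2)) := by
  rw [stdGaussian_eq_withDensity, integral_withDensity_eq_integral_toReal_smul
    (by fun_prop) (Eventually.of_forall fun x => ENNReal.ofReal_lt_top)]
  congr with x
  rw [ENNReal.toReal_ofReal (by positivity), smul_eq_mul, mul_comm]

theorem integral_exp_neg_half_norm_sq_stdGaussian :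
    ∫ x : E, Real.exp (-‖x‖ ^ 2 / 2) ∂(stdGaussian E) = (2 ^ (Module.finrank ℝ E / 2 : ℝ))⁻¹ := by
  rw [integral_stdGaussian]
  have h := GaussianFourier.integral_rexp_neg_mul_sq_norm (V := E) (b := 1) (by norm_num)
  have h1 : ∀ x : E, Real.exp (-‖x‖ ^ 2 / 2) * (((2 * Real.pi) ^ (Module.finrank ℝ E / 2 : ℝ))⁻¹ *
      Real.exp (-‖x‖ ^ 2 / 2)) =
      ((2 * Real.pi) ^ (Module.finrank ℝ E / 2 : ℝ))⁻¹ * Real.exp (-1 * ‖x‖ ^ 2) := fun x => by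
    rw [mul_left_comm, ← Real.exp_add]
    ring_nf
  simp only [h1]
  rw [integral_const_mul, h, div_one, Real.mul_rpow (by norm_num) Real.pi_pos.le, mul_inv, mul_assoc,
    inv_mul_cancel₀ (by positivity), mul_one]

variable (E) in
/-- The uniform probability measure on the unit sphere of a Euclidean space. -/
noncomputable def uniformSphere : Measure (Metric.sphere (0 : E) 1) :=
  ((volume : Measure E).toSphere Set.univ)⁻¹ • (volume : Measure E).toSphere

theorem isProbabilityMeasure_uniformSphere [Nontrivial E] :
    IsProbabilityMeasure (uniformSphere E) := by
  refine ⟨?_⟩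
  rw [uniformSphere, Measure.smul_apply, smul_eq_mul]
  refine ENNReal.inv_mul_cancel ?_ (measure_ne_top _ _)
  rw [Ne, Measure.measure_univ_eq_zero]
  exact Measure.toSphere_ne_zero _

/-- For a Gaussian vector, direction and norm are independent, and the direction is uniform. -/
theorem integral_stdGaussian_polar [Nontrivial E] (G : Metric.sphere (0 : E) 1 → ℝ) (H : ℝ → ℝ)
    (F : E → ℝ) (hF : ∀ (u : Metric.sphere (0 : E) 1) (r : ℝ), 0 < r → F (r • (u : E)) = G u * H r) :
    ∫ x, F x ∂(stdGaussian E) = (∫ u, G u ∂(uniformSphere E)) * ∫ x, H ‖x‖ ∂(stdGaussian E) := by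
  set w : ℝ → ℝ := fun r => ((2 * Real.pi) ^ (Module.finrank ℝ E / 2 : ℝ))⁻¹ *
    Real.exp (-r ^ 2 / 2) with hw
  have key : ∀ (G : Metric.sphere (0 : E) 1 → ℝ) (F : E → ℝ),
      (∀ (u : Metric.sphere (0 : E) 1) (r : ℝ), 0 < r → F (r • (u : E)) = G u * H r) →
      ∫ x, F x ∂(stdGaussian E) = (∫ u, G u ∂(volume : Measure E).toSphere) *
        ∫ r : Ioi (0 : ℝ), H r * w r ∂(Measure.volumeIoiPow (Module.finrank ℝ E - 1)) := by
    intro G F hF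
    have h0 : ∫ x, F x * w ‖x‖ = ∫ x in {0}ᶜ, F x * w ‖x‖ := by rw [restrict_compl_singleton]
    rw [integral_stdGaussian, h0, ← integral_prod_mul, ← integral_subtype_comap (measurableSet_singleton _).compl
        (fun x => F x * w ‖x‖),
      ← (volume : Measure E).measurePreserving_homeomorphUnitSphereProd.integral_comp
        (Homeomorph.measurableEmbedding _)]
    refine integral_congr_ae (Eventually.of_forall fun x => ?_)
    have hx : 0 < ‖(x : E)‖ := norm_pos_iff.2 x.2
    have h1 := hF (homeomorphUnitSphereProd E x).1 (homeomorphUnitSphereProd E x).2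
      (homeomorphUnitSphereProd E x).2.2
    simp only [homeomorphUnitSphereProd_apply_snd_coe, homeomorphUnitSphereProd_apply_fst_coe,
      smul_inv_smul₀ hx.ne'] at h1 ⊢
    rw [h1, mul_assoc]
  have h1 := key G F hF
  -- The case `G = 1` identifies the radial factor, so no surface area has to be computed.
  have h2 := key (fun _ => 1) (fun x => H ‖x‖) (fun u r hr => by
    simp [norm_smul, abs_of_pos hr])
  rw [h1, h2, uniformSphere, integral_smul_measure, integral_const, smul_eq_mul, smul_eq_mul,
    mul_one, ENNReal.toReal_inv, ← measureReal_def]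
  have h3 : (volume : Measure E).toSphere.real univ ≠ 0 := by
    rw [measureReal_def, ENNReal.toReal_ne_zero, Ne, Measure.measure_univ_eq_zero]
    exact ⟨Measure.toSphere_ne_zero _, measure_ne_top _ _⟩
  field_simp

end GaussianDensity

end AcidNorm

namespace AcidNorm

open Set Filter Topology

/-! ### Lévy's lemma -/

theorem exists_bounded_lipschitz_extension {X : Type*} [PseudoMetricSpace X] {f : X → ℝ}
    {s : Set X} {K : NNReal} {M : ℝ} (hf : LipschitzOnWith K f s) (hM0 : 0 ≤ M)
    (hM : ∀ x ∈ s, |f x| ≤ M) :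
    ∃ F : X → ℝ, LipschitzWith K F ∧ (∀ x, |F x| ≤ M) ∧ ∀ x ∈ s, F x = f x := by
  obtain ⟨F, hF, hFf⟩ := hf.extend_real
  refine ⟨fun x => max (-M) (min M (F x)), (hF.const_min M).const_max (-M), fun x => ?_,
    fun x hx => ?_⟩
  · exact abs_le.2 ⟨le_max_left _ _, max_le (by linarith) (min_le_left _ _)⟩
  · have h := abs_le.1 (hM x hx)
    beta_reduce
    rw [← hFf hx, min_eq_right h.2, max_eq_right h.1]

section Levy

variable {E : Type*} [NormedAddCommGroup E] [InnerProductSpace ℝ E]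

/-- Radial projection is `1/r₀`-Lipschitz outside the ball of radius `r₀`, by `‖r u - t v‖² = (r -
t)² + r t ‖u - v‖²`. -/
theorem mul_norm_sub_le_norm_smul_sub_smul {u v : E} (hu : ‖u‖ = 1) (hv : ‖v‖ = 1) {r t r₀ : ℝ}
    (h₀ : 0 ≤ r₀) (hr : r₀ ≤ r) (ht : r₀ ≤ t) : r₀ * ‖u - v‖ ≤ ‖r • u - t • v‖ := by
  refine le_of_sq_le_sq ?_ (norm_nonneg _)
  have h1 : ‖r • u - t • v‖ ^ 2 = (r - t) ^ 2 + r * t * ‖u - v‖ ^ 2 := by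
    rw [norm_sub_sq_real, norm_sub_sq_real, norm_smul, norm_smul, hu, hv, real_inner_smul_left,
      real_inner_smul_right]
    simp only [mul_one, Real.norm_eq_abs, sq_abs, one_pow]
    ring
  rw [h1, mul_pow]
  have : r₀ ^ 2 ≤ r * t := by nlinarith
  nlinarith [sq_nonneg (r - t), sq_nonneg ‖u - v‖]

/-- A Lipschitz function on the sphere extends from the outside of a ball, where it is taken to be
constant along rays, to a Lipschitz function on the whole space. -/
theorem exists_radial_extension {g : Metric.sphere (0 : E) 1 → ℝ} {K : NNReal} {M : ℝ}
    (hg : LipschitzWith K g) (hM0 : 0 ≤ M) (hM : ∀ u, |g u| ≤ M) {r₀ : NNReal} (hr₀ : 0 < r₀) :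
    ∃ F : E → ℝ, LipschitzWith (K / r₀) F ∧ (∀ x, |F x| ≤ M) ∧
      ∀ (u : Metric.sphere (0 : E) 1) (r : ℝ), r₀ ≤ r → F (r • (u : E)) = g u := by
  classical
  -- The default value is taken only at the origin, which lies inside the discarded ball.
  let g' : E → ℝ := fun x => if hx : ‖(‖x‖⁻¹ • x)‖ = 1 then g ⟨‖x‖⁻¹ • x, by simpa using hx⟩ else 0
  have hg' : ∀ (u : Metric.sphere (0 : E) 1) (r : ℝ), 0 < r → g' (r • (u : E)) = g u := by
    intro u r hr
    have hu : ‖(u : E)‖ = 1 := by simp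
    have h1 : ‖r • (u : E)‖⁻¹ • r • (u : E) = u := by
      rw [norm_smul, hu, Real.norm_eq_abs, abs_of_pos hr, mul_one, inv_smul_smul₀ hr.ne']
    have h2 : ‖(‖r • (u : E)‖⁻¹ • r • (u : E))‖ = 1 := by rw [h1, hu]
    simp only [g']
    rw [dif_pos h2]
    congr 1
    exact Subtype.ext h1
  have hray : ∀ x : E, (r₀ : ℝ) ≤ ‖x‖ → ∃ u : Metric.sphere (0 : E) 1, x = ‖x‖ • (u : E) := by
    intro x hx
    have hx0 : 0 < ‖x‖ := lt_of_lt_of_le (by exact_mod_cast hr₀) hx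
    exact ⟨⟨‖x‖⁻¹ • x, by simp [norm_smul, hx0.ne']⟩, (smul_inv_smul₀ hx0.ne' x).symm⟩
  have hlip : LipschitzOnWith (K / r₀) g' {x | (r₀ : ℝ) ≤ ‖x‖} := by
    refine LipschitzOnWith.of_dist_le_mul fun x hx y hy => ?_
    have hr0' : (0 : ℝ) < r₀ := by exact_mod_cast hr₀
    have hx0 : 0 < ‖x‖ := hr0'.trans_le hx
    have hy0 : 0 < ‖y‖ := hr0'.trans_le hy
    obtain ⟨u, hu⟩ := hray x hx
    obtain ⟨v, hv⟩ := hray y hy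
    have h1 := mul_norm_sub_le_norm_smul_sub_smul (u := (u : E)) (v := v) (by simp) (by simp)
      hr0'.le hx hy
    rw [← hu, ← hv] at h1
    have h2 := hg.dist_le_mul u v
    rw [Subtype.dist_eq, dist_eq_norm (u : E)] at h2
    have h3 : g' x = g u := by conv_lhs => rw [hu]; exact hg' u _ hx0
    have h4 : g' y = g v := by conv_lhs => rw [hv]; exact hg' v _ hy0
    rw [h3, h4, dist_eq_norm x y, NNReal.coe_div, div_mul_eq_mul_div, le_div_iff₀ hr0']
    nlinarith [mul_le_mul_of_nonneg_left h1 K.coe_nonneg]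
  obtain ⟨F, hF, hFM, hFg⟩ := exists_bounded_lipschitz_extension hlip hM0 fun x hx => by
    have hx0 : 0 < ‖x‖ := lt_of_lt_of_le (by exact_mod_cast hr₀) hx
    obtain ⟨u, hu⟩ := hray x hx
    rw [hu, hg' u _ hx0]
    exact hM u
  refine ⟨F, hF, hFM, fun u r hr => ?_⟩
  have hr0' : (0 : ℝ) < r₀ := by exact_mod_cast hr₀
  have hr' : 0 < r := hr0'.trans_le hr
  rw [hFg _ (by simpa [norm_smul, abs_of_pos hr'] using hr), hg' u r hr']

/-- The left side is the Chernoff bound for `‖x‖² ≤ n / 2`. It decreases in `n`, as `log 2 > 1/2`,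
and equals `e / 4` at `n = 4`. -/
theorem exp_quarter_mul_inv_two_rpow_le {n : ℝ} (hn : 4 ≤ n) :
    Real.exp (n / 4) * (2 ^ (n / 2))⁻¹ ≤ Real.exp 1 / 4 := by
  rw [Real.rpow_def_of_pos two_pos, ← Real.exp_neg, ← Real.exp_add]
  have h4 : (4 : ℝ) = Real.exp (2 * Real.log 2) := by
    rw [two_mul, Real.exp_add, Real.exp_log two_pos]; norm_num
  conv_rhs => rw [h4]
  rw [← Real.exp_sub]
  refine Real.exp_le_exp.2 ?_
  nlinarith [Real.log_two_gt_d9]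

/-! ### From Gaussian space to the sphere -/

variable [FiniteDimensional ℝ E] [MeasurableSpace E] [BorelSpace E]

theorem ae_ne_zero_stdGaussian [Nontrivial E] : ∀ᵐ x ∂(stdGaussian E), x ≠ 0 := by
  rw [stdGaussian_eq_withDensity]
  refine (withDensity_absolutelyContinuous _ _).ae_le ?_
  exact (measure_singleton (0 : E) : volume {(0 : E)} = 0) |> compl_mem_ae_iff.2

/-- The factor `e` pays for the mean of the Gaussian extension, at most `K / n`; this is where `l K
≤ n` enters. The factor `1 - e/4` bounds from below the probability that the Gaussian vector lies
outside the ball. -/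
theorem integral_exp_lipschitz_uniformSphere_le {g : Metric.sphere (0 : E) 1 → ℝ} {K : NNReal}
    (hn : 4 ≤ Module.finrank ℝ E) (hg : LipschitzWith K g)
    (hg0 : ∫ u, g u ∂(uniformSphere E) = 0) {M : ℝ} (hM : ∀ u, |g u| ≤ M) {l : ℝ} (hl : 0 ≤ l)
    (hlK : l * K ≤ Module.finrank ℝ E) :
    ∫ u, Real.exp (l * g u) ∂(uniformSphere E) ≤
      Real.exp 1 / (1 - Real.exp 1 / 4) * Real.exp (l ^ 2 * K ^ 2 / Module.finrank ℝ E) := by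
  have : Nontrivial E := Module.nontrivial_of_finrank_pos (R := ℝ) (by omega)
  have := isProbabilityMeasure_uniformSphere (E := E)
  obtain ⟨u₀⟩ := (NormedSpace.sphere_nonempty (x := (0 : E)) (r := 1)).2 zero_le_one
  have hM0 : 0 ≤ M := (abs_nonneg _).trans (hM ⟨u₀, by assumption⟩)
  set n : ℝ := (Module.finrank ℝ E : ℝ) with hn_def
  have hn4 : 4 ≤ n := by rw [hn_def]; exact_mod_cast hn
  have hn0 : 0 < n := by linarith
  set r₀ : NNReal := ⟨√(n / 2), Real.sqrt_nonneg _⟩ with hr₀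
  have hr₀v : (r₀ : ℝ) = √(n / 2) := rfl
  have hr₀pos : (0 : ℝ) < r₀ := by rw [hr₀v]; positivity
  have hr₀sq : (r₀ : ℝ) ^ 2 = n / 2 := by rw [hr₀v, Real.sq_sqrt (by positivity)]
  obtain ⟨F, hF, hFM, hFg⟩ := exists_radial_extension hg hM0 hM (by exact_mod_cast hr₀pos)
  -- Evaluated at radius 2, `f` gives a measurable form `G` of `g (x / ‖x‖)`, whose Gaussian mean is
  -- zero.
  obtain ⟨f, hf, hfM, hfg⟩ := exists_radial_extension hg hM0 hM (one_pos)
  have hFc := hF.continuous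
  have hfc := hf.continuous
  set γ := stdGaussian E with hγ
  set q : ℝ := Real.exp (n / 4) * (2 ^ (n / 2))⁻¹ with hq
  have hq4 : q ≤ Real.exp 1 / 4 := exp_quarter_mul_inv_two_rpow_le hn4
  have hqi : ∫ x : E, Real.exp (n / 4 - ‖x‖ ^ 2 / 2) ∂γ = q := by
    rw [hq, hn_def, ← integral_exp_neg_half_norm_sq_stdGaussian, ← integral_const_mul]
    congr with x
    rw [← Real.exp_add]
    congr 1
    ring
  have hqint : Integrable (fun x : E => Real.exp (n / 4 - ‖x‖ ^ 2 / 2)) γ := by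
    refine integrable_of_continuous_of_abs_le (M := Real.exp (n / 4)) (by fun_prop) fun x => ?_
    rw [Real.abs_exp]
    refine Real.exp_le_exp.2 ?_
    have := sq_nonneg ‖x‖
    linarith
  -- the mean of the extension
  have hmean : ∫ x, F x ∂γ ≤ K * (4 / (Real.exp 1 * n) * q) := by
    set G : E → ℝ := fun x => f ((2 / ‖x‖) • x) with hG
    have hGm : Measurable G := hfc.measurable.comp (by fun_prop)
    have hGi : Integrable G γ := Integrable.of_bound hGm.aestronglyMeasurable M
      (Eventually.of_forall fun x => hfM _)
    have hG0 : ∫ x, G x ∂γ = 0 := by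
      rw [integral_stdGaussian_polar g (fun _ => 1) G fun u r hr => ?_, hg0, zero_mul]
      have : ‖(u : E)‖ = 1 := by simp
      simp only [hG]
      rw [mul_one, smul_smul, norm_smul, this, Real.norm_eq_abs, abs_of_pos hr, mul_one,
        div_mul_cancel₀ _ hr.ne', hfg u 2 (by norm_num)]
    have hle : ∀ᵐ x ∂γ, F x ≤ G x +
        K * (4 / (Real.exp 1 * n)) * Real.exp (n / 4 - ‖x‖ ^ 2 / 2) := by
      filter_upwards [ae_ne_zero_stdGaussian (E := E)] with x hx
      have hx0 : 0 < ‖x‖ := norm_pos_iff.2 hx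
      let u : Metric.sphere (0 : E) 1 := ⟨‖x‖⁻¹ • x, by simp [norm_smul, hx0.ne']⟩
      have hxu : x = ‖x‖ • (u : E) := (smul_inv_smul₀ hx0.ne' x).symm
      have hGu : G x = g u := by
        rw [hG, ← hfg u 2 (by norm_num)]
        simp only [u, smul_smul, div_eq_mul_inv]
      have hc : 0 ≤ (K : ℝ) * (4 / (Real.exp 1 * n)) := by positivity
      rw [hGu]
      rcases le_total (r₀ : ℝ) ‖x‖ with hr | hr
      · have : F x = g u := by conv_lhs => rw [hxu]; exact hFg u _ hr
        rw [this]
        have := mul_nonneg hc (Real.exp_pos (n / 4 - ‖x‖ ^ 2 / 2)).le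
        linarith
      · have h1 := (le_abs_self _).trans (hF.dist_le_mul x ((r₀ : ℝ) • (u : E)))
        have h2 : dist x ((r₀ : ℝ) • (u : E)) = r₀ - ‖x‖ := by
          conv_lhs => rw [hxu]
          have : ‖(u : E)‖ = 1 := by simp
          rw [dist_eq_norm, ← sub_smul, norm_smul, this, mul_one, Real.norm_eq_abs,
            abs_of_nonpos (by linarith)]
          ring
        rw [h2, hFg u _ le_rfl, NNReal.coe_div] at h1
        have h3 : ((K : ℝ) / r₀) * (r₀ - ‖x‖) = K * (1 - ‖x‖ / r₀) := by
          field_simp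
        rw [h3] at h1
        -- The defect inside the ball is made quadratic in `‖x‖`, then exponential by `u ≤ e^(u-1)`,
        -- so that its Gaussian mean is the known quantity `q`.
        have h4 : 1 - ‖x‖ / r₀ ≤ 1 - (‖x‖ / r₀) ^ 2 := by
          have h5 : ‖x‖ / r₀ ≤ 1 := (div_le_one hr₀pos).2 hr
          have h6 : 0 ≤ ‖x‖ / r₀ := by positivity
          nlinarith
        have h7 : 1 - (‖x‖ / r₀) ^ 2 = 4 / n * (n / 4 - ‖x‖ ^ 2 / 2) := by
          rw [div_pow, hr₀sq]
          field_simp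
          ring
        have h8 : n / 4 - ‖x‖ ^ 2 / 2 ≤ Real.exp (n / 4 - ‖x‖ ^ 2 / 2) / Real.exp 1 := by
          rw [← Real.exp_sub]
          have := Real.add_one_le_exp (n / 4 - ‖x‖ ^ 2 / 2 - 1)
          linarith
        have h9 : 1 - ‖x‖ / r₀ ≤ 4 / n * (Real.exp (n / 4 - ‖x‖ ^ 2 / 2) / Real.exp 1) := by
          rw [h7] at h4
          exact h4.trans (mul_le_mul_of_nonneg_left h8 (by positivity))
        have h10 := mul_le_mul_of_nonneg_left h9 K.coe_nonneg
        have h11 : (K : ℝ) * (4 / n * (Real.exp (n / 4 - ‖x‖ ^ 2 / 2) / Real.exp 1)) =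
            K * (4 / (Real.exp 1 * n)) * Real.exp (n / 4 - ‖x‖ ^ 2 / 2) := by
          field_simp
        linarith
    have h := integral_mono_ae (integrable_of_continuous_of_abs_le hFc hFM)
      (hGi.add (hqint.const_mul _)) hle
    simp only [Pi.add_apply] at h
    rw [integral_add hGi (hqint.const_mul _), hG0, integral_const_mul, hqi] at h
    linarith
  have hlmean : l * ∫ x, F x ∂γ ≤ 1 := by
    have h1 : 4 / (Real.exp 1 * n) * q ≤ 1 / n := by
      calc 4 / (Real.exp 1 * n) * q ≤ 4 / (Real.exp 1 * n) * (Real.exp 1 / 4) := by gcongr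
        _ = 1 / n := by field_simp
    calc l * ∫ x, F x ∂γ ≤ l * (K * (1 / n)) :=
          mul_le_mul_of_nonneg_left (hmean.trans (by gcongr)) hl
      _ = l * K / n := by ring
      _ ≤ 1 := (div_le_one hn0).2 hlK
  have hupper : ∫ x, Real.exp (l * F x) ∂γ ≤ Real.exp (1 + l ^ 2 * K ^ 2 / n) := by
    refine (integral_exp_lipschitz_stdGaussian_le hF hFM hl).trans (Real.exp_le_exp.2 ?_)
    rw [NNReal.coe_div, div_pow, hr₀sq]
    have : l ^ 2 * ((K : ℝ) ^ 2 / (n / 2)) / 2 = l ^ 2 * K ^ 2 / n := by field_simp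
    rw [this]
    gcongr
  -- lower bound by the contribution of large radii
  have hexpi : Integrable (fun x => Real.exp (l * F x)) γ := by
    refine integrable_of_continuous_of_abs_le (M := Real.exp (l * M)) (by fun_prop) fun x => ?_
    rw [Real.abs_exp]
    exact Real.exp_le_exp.2 (mul_le_mul_of_nonneg_left ((abs_le.1 (hFM x)).2) hl)
  set S : Set ℝ := Ici (r₀ : ℝ) with hS
  have hSm : MeasurableSet {x : E | ‖x‖ ∈ S} := measurable_norm measurableSet_Ici
  have hlow : (∫ u, Real.exp (l * g u) ∂(uniformSphere E)) * ∫ x : E, S.indicator 1 ‖x‖ ∂γ ≤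
      ∫ x, Real.exp (l * F x) ∂γ := by
    rw [← integral_stdGaussian_polar (fun u => Real.exp (l * g u)) (S.indicator 1)
      ({x : E | ‖x‖ ∈ S}.indicator fun x => Real.exp (l * F x)) fun u r hr => ?_]
    · refine integral_mono (hexpi.indicator hSm) hexpi fun x => ?_
      exact indicator_le_self' (fun _ _ => (Real.exp_pos _).le) x
    · have hu : ‖r • (u : E)‖ = r := by simp [norm_smul, abs_of_pos hr]
      by_cases h : r ∈ S
      · rw [indicator_of_mem (by simpa [hu] using h), indicator_of_mem h, hFg u r h]
        simp
      · rw [indicator_of_notMem (by simpa [hu] using h), indicator_of_notMem h, mul_zero]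
  -- On the ball `‖x‖² ≤ n / 2` the integrand defining `q` is at least 1.
  have hprob : 1 - q ≤ ∫ x : E, S.indicator 1 ‖x‖ ∂γ := by
    rw [← hqi]
    have h1 : (1 : ℝ) = ∫ x : E, (1 : ℝ) ∂γ := by simp [hγ]
    conv_lhs => rw [h1]
    rw [← integral_sub (integrable_const _) hqint]
    refine integral_mono ((integrable_const _).sub hqint) ?_ fun x => ?_
    · have : (fun x : E => S.indicator (1 : ℝ → ℝ) ‖x‖) = {x : E | ‖x‖ ∈ S}.indicator fun _ => 1 := by
        funext x
        simp [indicator]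
      rw [this]
      exact (integrable_const _).indicator hSm
    · by_cases h : ‖x‖ ∈ S
      · simp only [indicator_of_mem h, Pi.one_apply]
        linarith [Real.exp_pos (n / 4 - ‖x‖ ^ 2 / 2)]
      · simp only [indicator_of_notMem h]
        have h2 : ‖x‖ < r₀ := by simpa [hS] using h
        have h3 : ‖x‖ ^ 2 ≤ n / 2 := by
          rw [← hr₀sq]
          gcongr
        have := Real.one_le_exp (x := n / 4 - ‖x‖ ^ 2 / 2) (by linarith)
        linarith
  have he4 : 0 < 1 - Real.exp 1 / 4 := by linarith [Real.exp_one_lt_d9]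
  have hA : 0 ≤ ∫ u, Real.exp (l * g u) ∂(uniformSphere E) :=
    integral_nonneg fun u => (Real.exp_pos _).le
  rw [div_mul_eq_mul_div, le_div_iff₀ he4, ← Real.exp_add]
  calc (∫ u, Real.exp (l * g u) ∂(uniformSphere E)) * (1 - Real.exp 1 / 4)
      ≤ (∫ u, Real.exp (l * g u) ∂(uniformSphere E)) * ∫ x : E, S.indicator 1 ‖x‖ ∂γ :=
        mul_le_mul_of_nonneg_left (by linarith) hA
    _ ≤ _ := hlow.trans hupper

theorem measureReal_uniformSphere_ge_le {g : Metric.sphere (0 : E) 1 → ℝ} {K : NNReal}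
    (hK : 0 < K) (hn : 4 ≤ Module.finrank ℝ E) (hg : LipschitzWith K g)
    (hg0 : ∫ u, g u ∂(uniformSphere E) = 0) {M : ℝ} (hM : ∀ u, |g u| ≤ M) {s : ℝ} (hs : 0 ≤ s)
    (hsK : s ≤ 2 * K) :
    (uniformSphere E).real {u | s ≤ g u} ≤ Real.exp 1 / (1 - Real.exp 1 / 4) *
      Real.exp (-(Module.finrank ℝ E * s ^ 2 / (4 * K ^ 2))) := by
  have : Nontrivial E := Module.nontrivial_of_finrank_pos (R := ℝ) (by omega)
  have := isProbabilityMeasure_uniformSphere (E := E)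
  have hK' : (0 : ℝ) < K := by exact_mod_cast hK
  have hgc := hg.continuous
  set n : ℝ := (Module.finrank ℝ E : ℝ) with hn_def
  have hn4 : 4 ≤ n := by rw [hn_def]; exact_mod_cast hn
  -- The minimizer of `-l s + l² K² / n`; the constraint `l K ≤ n` becomes `s ≤ 2 K`.
  set l : ℝ := n * s / (2 * K ^ 2) with hl_def
  have hl : 0 ≤ l := by positivity
  have hlK : l * K ≤ n := by
    have : l * K = n * (s / (2 * K)) := by rw [hl_def]; field_simp
    rw [this]
    exact mul_le_of_le_one_right (by linarith) ((div_le_one (by positivity)).2 hsK)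
  have h1 := measure_ge_le_exp_mul_mgf (μ := uniformSphere E) (X := g) s hl (by
    refine integrable_of_continuous_of_abs_le (M := Real.exp (l * M)) (by fun_prop) fun x => ?_
    rw [Real.abs_exp]
    exact Real.exp_le_exp.2 (mul_le_mul_of_nonneg_left ((abs_le.1 (hM x)).2) hl))
  refine h1.trans ((mul_le_mul_of_nonneg_left (integral_exp_lipschitz_uniformSphere_le hn hg hg0 hM
    hl hlK) (Real.exp_pos _).le).trans (le_of_eq ?_))
  rw [mul_left_comm, ← Real.exp_add]
  congr 2
  rw [← hn_def, hl_def]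
  field_simp
  ring

/-- Lévy's lemma: concentration of Lipschitz functions on the sphere around their mean. -/
theorem measureReal_uniformSphere_abs_sub_integral_ge_le [Nontrivial E]
    {f : Metric.sphere (0 : E) 1 → ℝ} {K : NNReal} (hK : 0 < K) (hf : LipschitzWith K f) {s : ℝ}
    (hs : 0 ≤ s) :
    (uniformSphere E).real {u | s ≤ |f u - ∫ v, f v ∂(uniformSphere E)|} ≤
      Real.exp (Real.pi - Module.finrank ℝ E * s ^ 2 / (4 * K ^ 2)) := by
  have := isProbabilityMeasure_uniformSphere (E := E)
  have hK' : (0 : ℝ) < K := by exact_mod_cast hK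
  have hfc := hf.continuous
  have hfi : Integrable f (uniformSphere E) :=
    hfc.integrable_of_hasCompactSupport (HasCompactSupport.of_compactSpace f)
  set m : ℝ := ∫ v, f v ∂(uniformSphere E) with hm
  set g : Metric.sphere (0 : E) 1 → ℝ := fun u => f u - m with hg_def
  have hg0 : ∫ u, g u ∂(uniformSphere E) = 0 := by
    rw [hg_def, integral_sub hfi (integrable_const _)]
    simp [← hm]
  have hgl : LipschitzWith K g := LipschitzWith.of_dist_le_mul fun u v => by
    simpa [hg_def] using hf.dist_le_mul u v
  have hgM : ∀ u, |g u| ≤ 2 * K := fun u => by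
    have h1 : g u = ∫ v, (f u - f v) ∂(uniformSphere E) := by
      rw [integral_sub (integrable_const _) hfi]
      simp [← hm, hg_def]
    rw [h1]
    refine abs_integral_le_of_abs_le fun v => (hf.dist_le_mul u v).trans ?_
    rw [mul_comm]
    gcongr
    rw [Subtype.dist_eq, dist_eq_norm]
    have := norm_sub_le (u : E) v
    have h2 : ‖(u : E)‖ = 1 := by simp
    have h3 : ‖(v : E)‖ = 1 := by simp
    linarith
  rcases lt_or_ge (2 * (K : ℝ)) s with hsK | hsK
  · have : {u | s ≤ |g u|} = ∅ := eq_empty_of_forall_notMem fun u hu => by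
      have h1 : s ≤ |g u| := hu
      linarith [hgM u]
    rw [this, measureReal_empty]
    positivity
  -- In dimension at most 3 the subtracted term is at most `3 < π`, so the bound exceeds 1.
  rcases Nat.lt_or_ge (Module.finrank ℝ E) 4 with hn | hn
  · refine measureReal_le_one.trans (Real.one_le_exp ?_)
    have h1 : (Module.finrank ℝ E : ℝ) ≤ 3 := by exact_mod_cast Nat.le_of_lt_succ hn
    have h2 : s ^ 2 / (4 * K ^ 2) ≤ 1 := by
      rw [div_le_one (by positivity)]
      nlinarith
    have h3 : (Module.finrank ℝ E : ℝ) * s ^ 2 / (4 * K ^ 2) ≤ 3 * 1 := by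
      rw [mul_div_assoc]
      exact mul_le_mul h1 h2 (by positivity) (by norm_num)
    linarith [Real.pi_gt_three]
  · have h1 := measureReal_uniformSphere_ge_le hK hn hgl hg0 hgM hs hsK
    have hgl' : LipschitzWith K fun u => -g u := hgl.neg
    have h2 := measureReal_uniformSphere_ge_le hK hn hgl' (by rw [integral_neg, hg0, neg_zero])
      (fun u => by rw [abs_neg]; exact hgM u) hs hsK
    have h3 : {u | s ≤ |g u|} ⊆ {u | s ≤ g u} ∪ {u | s ≤ -g u} := fun u hu => by
      have h4 : s ≤ |g u| := hu
      exact le_abs.1 h4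
    refine (measureReal_mono h3).trans ((measureReal_union_le _ _).trans ((add_le_add h1 h2).trans ?_))
    rw [sub_eq_add_neg Real.pi, Real.exp_add, ← two_mul, ← mul_assoc]
    refine mul_le_mul_of_nonneg_right ?_ (Real.exp_pos _).le
    have he1 := Real.exp_one_gt_d9
    have he2 := Real.exp_one_lt_d9
    -- Two tails give the factor `2e / (1 - e/4)`, which is below `e³`.
    have h5 : Real.exp 1 ^ 3 ≤ Real.exp Real.pi := by
      rw [← Real.exp_nat_mul]
      exact Real.exp_le_exp.2 (by push_cast; linarith [Real.pi_gt_three])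
    refine le_trans ?_ h5
    rw [← mul_div_assoc, div_le_iff₀ (by linarith)]
    have h6 : 2 ≤ Real.exp 1 ^ 2 * (1 - Real.exp 1 / 4) := by nlinarith
    nlinarith

end Levy

end AcidNorm

namespace AcidNorm

open scoped Matrix.Norms.L2Operator

/-! ### Duality for the trace norm -/

/-- Bessel's inequality; zero vectors contribute nothing because `0⁻¹ = 0`. -/
theorem sum_sq_norm_inner_normalize_le {ι H : Type*} [Fintype ι] [NormedAddCommGroup H]
    [InnerProductSpace ℂ H] {t : ι → H} (ht : Pairwise fun i j => inner ℂ (t i) (t j) = 0) (x : H) :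
    ∑ i, ‖inner ℂ ((‖t i‖⁻¹ : ℂ) • t i) x‖ ^ 2 ≤ ‖x‖ ^ 2 := by
  classical
  have hon : Orthonormal ℂ (fun i : {i // t i ≠ 0} => (‖t i‖⁻¹ : ℂ) • t i) := by
    constructor
    · rintro ⟨i, hi⟩
      rw [norm_smul, norm_inv, Complex.norm_real, norm_norm, inv_mul_cancel₀ (norm_ne_zero_iff.2 hi)]
    · rintro ⟨i, hi⟩ ⟨j, hj⟩ hij
      rw [inner_smul_left, inner_smul_right, ht fun h => hij (Subtype.ext h)]
      simp
  refine le_trans (le_of_eq ?_) (hon.sum_inner_products_le x (s := Finset.univ))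
  rw [← Finset.sum_subtype (Finset.univ.filter fun i => t i ≠ 0) (by simp)
    (fun i => ‖inner ℂ ((‖t i‖⁻¹ : ℂ) • t i) x‖ ^ 2), Finset.sum_filter_of_ne]
  intro i _ hi h0
  simp [h0] at hi

/-- An orthogonal family is mapped by a contraction onto multiples of an orthonormal basis. -/
theorem exists_contraction_apply_eq {ι H₁ H₂ : Type*} [Fintype ι] [NormedAddCommGroup H₁]
    [InnerProductSpace ℂ H₁] [NormedAddCommGroup H₂] [InnerProductSpace ℂ H₂] {t : ι → H₁}
    (ht : Pairwise fun i j => inner ℂ (t i) (t j) = 0) (v : OrthonormalBasis ι ℂ H₂) :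
    ∃ W : H₁ →ₗ[ℂ] H₂, (∀ x, ‖W x‖ ≤ ‖x‖) ∧ (∀ i, W (t i) = (‖t i‖ : ℂ) • v i) ∧
      ∀ i x, ‖t i‖ * inner ℂ (v i) (W x) = inner ℂ (t i) x := by
  let w : ι → H₁ := fun i => (‖t i‖⁻¹ : ℂ) • t i
  let W : H₁ →ₗ[ℂ] H₂ := ∑ i, (innerₛₗ ℂ (w i)).smulRight (v i)
  have hW : ∀ x, W x = ∑ i, inner ℂ (w i) x • v i := fun x => by
    simp [W]
  refine ⟨W, fun x => le_of_sq_le_sq ?_ (norm_nonneg x), fun i => ?_, fun i x => ?_⟩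
  · have h1 : W x = v.repr.symm (WithLp.toLp 2 fun i => inner ℂ (w i) x) := by
      rw [hW, ← v.sum_repr_symm]
    rw [h1, LinearIsometryEquiv.norm_map, EuclideanSpace.norm_sq_eq]
    exact sum_sq_norm_inner_normalize_le ht x
  · rw [hW, Finset.sum_eq_single i]
    · congr 1
      simp only [w, inner_smul_left]
      rw [inner_self_eq_norm_sq_to_K]
      by_cases h : ‖t i‖ = 0
      · simp [h]
      · have : (‖t i‖ : ℂ) ≠ 0 := by exact_mod_cast h
        simp only [map_inv₀, Complex.conj_ofReal, Complex.coe_algebraMap]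
        field_simp
    · intro j _ hj
      simp only [w, inner_smul_left, ht hj, mul_zero, zero_smul]
    · simp
  · rw [hW, inner_sum, Finset.sum_eq_single i]
    · simp only [inner_smul_right, w, inner_smul_left, inner_self_eq_norm_sq_to_K, v.norm_eq_one]
      by_cases h : t i = 0
      · simp [h]
      · have : (‖t i‖ : ℂ) ≠ 0 := by exact_mod_cast norm_ne_zero_iff.2 h
        simp only [map_inv₀, Complex.conj_ofReal, Complex.coe_algebraMap]
        field_simp
        simp
    · intro j _ hj
      rw [inner_smul_right, v.inner_eq_zero hj.symm, mul_zero]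
    · simp

section TraceNorm

variable {a b c e : Type*} [Fintype a] [Fintype b] [DecidableEq b]

/-- The right singular vectors of a matrix. -/
theorem exists_singular_basis (A : Matrix a b ℂ) :
    ∃ v : OrthonormalBasis (Fin (Fintype.card b)) ℂ (EuclideanSpace ℂ b),
      (∑ i, ‖Matrix.toEuclideanLin A (v i)‖ = traceNorm A) ∧
      ∀ i j, i ≠ j →
        inner ℂ (Matrix.toEuclideanLin A (v i)) (Matrix.toEuclideanLin A (v j)) = 0 := by
  set T := Matrix.toEuclideanLin A with hT
  have hn : Module.finrank ℂ (EuclideanSpace ℂ b) = Fintype.card b := finrank_euclideanSpace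
  set hs := T.isSymmetric_adjoint_comp_self
  set v := hs.eigenvectorBasis hn with hv
  have hinner : ∀ i j, inner ℂ (T (v i)) (T (v j)) = hs.eigenvalues hn j * inner ℂ (v i) (v j) := by
    intro i j
    rw [← LinearMap.adjoint_inner_right, ← LinearMap.comp_apply, hv,
      hs.apply_eigenvectorBasis hn j, inner_smul_right]
    rfl
  refine ⟨v, ?_, fun i j hij => ?_⟩
  · rw [traceNorm, Finset.sum_range]
    refine Finset.sum_congr rfl fun i _ => ?_
    rw [LinearMap.singularValues_fin _ hn, ← Real.sqrt_sq (norm_nonneg (T (v i)))]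
    congr 1
    have h := hinner i i
    rw [inner_self_eq_norm_sq_to_K, inner_self_eq_norm_sq_to_K, v.norm_eq_one] at h
    simp only [Complex.coe_algebraMap, Complex.ofReal_one, one_pow, mul_one] at h
    exact_mod_cast h
  · rw [hinner, v.inner_eq_zero hij, mul_zero]

theorem traceNorm_nonneg (A : Matrix a b ℂ) : 0 ≤ traceNorm A :=
  Finset.sum_nonneg fun i _ => LinearMap.singularValues_nonneg _ i

theorem norm_toEuclideanLin_le (A : Matrix a b ℂ) (x : EuclideanSpace ℂ b) :
    ‖Matrix.toEuclideanLin A x‖ ≤ ‖A‖ * ‖x‖ := Matrix.l2_opNorm_mulVec A x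

theorem l2_opNorm_le_of_forall_le {A : Matrix a b ℂ} {C : ℝ} (hC : 0 ≤ C)
    (h : ∀ x : EuclideanSpace ℂ b, ‖Matrix.toEuclideanLin A x‖ ≤ C * ‖x‖) : ‖A‖ ≤ C := by
  rw [Matrix.l2_opNorm_def]
  exact ContinuousLinearMap.opNorm_le_bound _ hC h

theorem trace_eq_sum_inner_toEuclideanLin {ι : Type*} [Fintype ι] (A : Matrix b b ℂ)
    (v : OrthonormalBasis ι ℂ (EuclideanSpace ℂ b)) :
    A.trace = ∑ i, inner ℂ (v i) (Matrix.toEuclideanLin A (v i)) := by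
  rw [← LinearMap.trace_eq_sum_inner]
  change _ = LinearMap.trace ℂ _ (Matrix.toLpLin 2 2 A)
  rw [Matrix.toLpLin_eq_toLin, Matrix.trace_toLin_eq]

theorem traceNorm_eq_zero {A : Matrix a b ℂ} (h : traceNorm A = 0) : A = 0 := by
  obtain ⟨v, hv, -⟩ := exists_singular_basis A
  rw [h, Finset.sum_eq_zero_iff_of_nonneg fun i _ => norm_nonneg _] at hv
  refine Matrix.toEuclideanLin.map_eq_zero_iff.1 (v.toBasis.ext fun i => ?_)
  simpa using hv i (Finset.mem_univ i)

/-- The singular value decomposition as a sum of rank-one matrices. -/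
theorem exists_sum_vecMulVec (A : Matrix a b ℂ) :
    ∃ (x : Fin (Fintype.card b) → EuclideanSpace ℂ a) (y : Fin (Fintype.card b) → EuclideanSpace ℂ b),
      A = ∑ i, Matrix.vecMulVec (x i) (star (y i).ofLp) ∧ ∑ i, ‖x i‖ * ‖y i‖ = traceNorm A := by
  obtain ⟨v, hv, -⟩ := exists_singular_basis A
  refine ⟨fun i => Matrix.toEuclideanLin A (v i), v, ?_, by simpa using hv⟩
  refine Matrix.toEuclideanLin.injective (v.toBasis.ext fun j => ?_)
  rw [map_sum, LinearMap.sum_apply, Finset.sum_eq_single j]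
  · ext p
    have h1 : star (v j).ofLp ⬝ᵥ (v j).ofLp = 1 := by
      have := EuclideanSpace.inner_eq_star_dotProduct (v j) (v j)
      rw [inner_self_eq_norm_sq_to_K, v.norm_eq_one, dotProduct_comm] at this
      simpa using this.symm
    simp [Matrix.toLpLin_apply, Matrix.vecMulVec_mulVec, h1]
  · intro i _ hij
    ext p
    have h1 : star (v i).ofLp ⬝ᵥ (v j).ofLp = 0 := by
      have := EuclideanSpace.inner_eq_star_dotProduct (v i) (v j)
      rw [v.inner_eq_zero hij, dotProduct_comm] at this
      exact this.symm
    simp [Matrix.toLpLin_apply, Matrix.vecMulVec_mulVec, h1]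
  · simp

variable [DecidableEq a]

theorem norm_trace_mul_le (V : Matrix b a ℂ) (A : Matrix a b ℂ) :
    ‖(V * A).trace‖ ≤ ‖V‖ * traceNorm A := by
  obtain ⟨v, hv, -⟩ := exists_singular_basis A
  rw [trace_eq_sum_inner_toEuclideanLin _ v, ← hv, Finset.mul_sum]
  refine (norm_sum_le _ _).trans (Finset.sum_le_sum fun i _ => ?_)
  refine (norm_inner_le_norm _ _).trans ?_
  rw [v.norm_eq_one, one_mul, Matrix.toLpLin_mul (q := 2), LinearMap.comp_apply]
  exact norm_toEuclideanLin_le _ _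

/-- In a right singular basis `v`, the contraction sending `A vᵢ` to `‖A vᵢ‖ vᵢ` attains the dual
norm. -/
theorem exists_trace_mul_eq_traceNorm (A : Matrix a b ℂ) :
    ∃ V : Matrix b a ℂ, ‖V‖ ≤ 1 ∧ (V * A).trace = traceNorm A := by
  obtain ⟨v, hv, horth⟩ := exists_singular_basis A
  obtain ⟨W, hW, hWt, -⟩ := exists_contraction_apply_eq (fun i j hij => horth i j hij) v
  refine ⟨Matrix.toEuclideanLin.symm W, l2_opNorm_le_of_forall_le zero_le_one fun x => ?_, ?_⟩
  · rw [LinearEquiv.apply_symm_apply, one_mul]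
    exact hW x
  · rw [trace_eq_sum_inner_toEuclideanLin _ v, ← hv, Complex.ofReal_sum]
    refine Finset.sum_congr rfl fun i _ => ?_
    rw [Matrix.toLpLin_mul (q := 2), LinearMap.comp_apply, LinearEquiv.apply_symm_apply, hWt,
      inner_smul_right, inner_self_eq_norm_sq_to_K, v.norm_eq_one]
    simp

theorem traceNorm_le_of_forall_trace_le {A : Matrix a b ℂ} {C : ℝ}
    (h : ∀ V : Matrix b a ℂ, ‖V‖ ≤ 1 → ‖(V * A).trace‖ ≤ C) : traceNorm A ≤ C := by
  obtain ⟨V, hV, htr⟩ := exists_trace_mul_eq_traceNorm A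
  have := h V hV
  rwa [htr, Complex.norm_real, Real.norm_eq_abs, abs_of_nonneg (traceNorm_nonneg A)] at this

theorem norm_trace_mul_le_traceNorm {V : Matrix b a ℂ} (hV : ‖V‖ ≤ 1) (A : Matrix a b ℂ) :
    ‖(V * A).trace‖ ≤ traceNorm A :=
  (norm_trace_mul_le V A).trans (mul_le_of_le_one_left (traceNorm_nonneg A) hV)

theorem traceNorm_add_le (A B : Matrix a b ℂ) : traceNorm (A + B) ≤ traceNorm A + traceNorm B :=
  traceNorm_le_of_forall_trace_le fun V hV => by
    rw [Matrix.mul_add, Matrix.trace_add]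
    exact (norm_add_le _ _).trans (add_le_add (norm_trace_mul_le_traceNorm hV A)
      (norm_trace_mul_le_traceNorm hV B))

theorem traceNorm_zero : traceNorm (0 : Matrix a b ℂ) = 0 :=
  le_antisymm (traceNorm_le_of_forall_trace_le fun V _ => by simp) (traceNorm_nonneg _)

theorem traceNorm_smul (z : ℂ) (A : Matrix a b ℂ) : traceNorm (z • A) = ‖z‖ * traceNorm A := by
  have hle : ∀ (z : ℂ) (A : Matrix a b ℂ), traceNorm (z • A) ≤ ‖z‖ * traceNorm A := fun z A =>
    traceNorm_le_of_forall_trace_le fun V hV => by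
      rw [Matrix.mul_smul, Matrix.trace_smul, norm_smul]
      exact mul_le_mul_of_nonneg_left (norm_trace_mul_le_traceNorm hV A) (norm_nonneg z)
  refine le_antisymm (hle z A) ?_
  rcases eq_or_ne z 0 with rfl | hz
  · simpa using traceNorm_nonneg (0 : Matrix a b ℂ)
  · have h := hle z⁻¹ (z • A)
    rw [inv_smul_smul₀ hz, norm_inv] at h
    rwa [le_inv_mul_iff₀ (norm_pos_iff.2 hz)] at h

theorem traceNorm_sum_le {ι : Type*} (s : Finset ι) (A : ι → Matrix a b ℂ) :
    traceNorm (∑ i ∈ s, A i) ≤ ∑ i ∈ s, traceNorm (A i) := by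
  classical
  induction s using Finset.induction_on with
  | empty => simp [traceNorm_zero]
  | insert i s hi ih =>
    rw [Finset.sum_insert hi, Finset.sum_insert hi]
    exact (traceNorm_add_le _ _).trans (by gcongr)

variable [Fintype c] [DecidableEq c] [Fintype e] [DecidableEq e]

theorem traceNorm_mul_mul_le (C : Matrix c a ℂ) (A : Matrix a b ℂ) (D : Matrix b e ℂ) :
    traceNorm (C * A * D) ≤ ‖C‖ * ‖D‖ * traceNorm A := by
  refine traceNorm_le_of_forall_trace_le fun V hV => ?_
  have h1 : (V * (C * A * D)).trace = (D * V * C * A).trace := by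
    rw [Matrix.trace_mul_comm, Matrix.mul_assoc (C * A), Matrix.mul_assoc C, Matrix.trace_mul_comm,
      Matrix.mul_assoc, Matrix.trace_mul_comm]
  rw [h1]
  refine (norm_trace_mul_le _ _).trans (mul_le_mul_of_nonneg_right ?_ (traceNorm_nonneg A))
  calc ‖D * V * C‖ ≤ ‖D‖ * ‖V‖ * ‖C‖ := (Matrix.l2_opNorm_mul _ _).trans
        (mul_le_mul_of_nonneg_right (Matrix.l2_opNorm_mul _ _) (norm_nonneg _))
    _ ≤ ‖D‖ * 1 * ‖C‖ := by gcongr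
    _ = ‖C‖ * ‖D‖ := by ring

theorem traceNorm_vecMulVec_le (x : EuclideanSpace ℂ a) (y : EuclideanSpace ℂ b) :
    traceNorm (Matrix.vecMulVec x (star y.ofLp)) ≤ ‖x‖ * ‖y‖ := by
  refine traceNorm_le_of_forall_trace_le fun V hV => ?_
  have h1 : (V * Matrix.vecMulVec x (star y.ofLp)).trace =
      inner ℂ y (Matrix.toEuclideanLin V x) := by
    rw [Matrix.mul_vecMulVec, Matrix.trace_vecMulVec, EuclideanSpace.inner_eq_star_dotProduct]
    rfl
  rw [h1]
  calc ‖inner ℂ y (Matrix.toEuclideanLin V x)‖ ≤ ‖y‖ * ‖Matrix.toEuclideanLin V x‖ :=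
        norm_inner_le_norm _ _
    _ ≤ ‖y‖ * (1 * ‖x‖) := by
        gcongr
        exact (norm_toEuclideanLin_le V x).trans (by gcongr)
    _ = ‖x‖ * ‖y‖ := by ring

end TraceNorm

theorem traceNorm_map_le_of_rank_one {a b c e : Type*} [Fintype a] [Fintype b] [DecidableEq b]
    [Fintype c] [DecidableEq c] [Fintype e] [DecidableEq e] (Φ : Matrix a b ℂ →ₗ[ℂ] Matrix c e ℂ) {C : ℝ}
    (h : ∀ (x : EuclideanSpace ℂ a) (y : EuclideanSpace ℂ b),
      traceNorm (Φ (Matrix.vecMulVec x (star y.ofLp))) ≤ C * (‖x‖ * ‖y‖)) (A : Matrix a b ℂ) :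
    traceNorm (Φ A) ≤ C * traceNorm A := by
  obtain ⟨x, y, hA, hn⟩ := exists_sum_vecMulVec A
  rw [← hn, Finset.mul_sum]
  conv_lhs => rw [hA, map_sum]
  exact (traceNorm_sum_le _ _).trans (Finset.sum_le_sum fun i _ => h _ _)

end AcidNorm

namespace AcidNorm

/-! ### Polar decomposition -/

section Polar

open scoped ComplexOrder

variable {a b : Type*} [Fintype a] [DecidableEq a] [Fintype b]

theorem posSemidef_cfcSqrt (ρ : Matrix a a ℂ) : (CFC.sqrt ρ).PosSemidef :=
  Matrix.nonneg_iff_posSemidef.1 (CFC.sqrt_nonneg ρ)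

theorem isHermitian_cfcSqrt (ρ : Matrix a a ℂ) : (CFC.sqrt ρ).IsHermitian :=
  (posSemidef_cfcSqrt ρ).isHermitian

theorem cfcSqrt_mul_conjTranspose (M : Matrix a b ℂ) :
    CFC.sqrt (M * Mᴴ) * CFC.sqrt (M * Mᴴ) = M * Mᴴ :=
  CFC.sqrt_mul_sqrt_self _ (Matrix.nonneg_iff_posSemidef.2 (Matrix.posSemidef_self_mul_conjTranspose M))

open scoped Matrix.Norms.L2Operator

variable [DecidableEq b]

theorem inner_toEuclideanLin_right (A : Matrix a b ℂ) (x : EuclideanSpace ℂ a)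
    (y : EuclideanSpace ℂ b) :
    inner ℂ x (Matrix.toEuclideanLin A y) = inner ℂ (Matrix.toEuclideanLin Aᴴ x) y := by
  rw [Matrix.toEuclideanLin_conjTranspose_eq_adjoint, LinearMap.adjoint_inner_left]

theorem toEuclideanLin_mul_apply {a b c : Type*} [Fintype b] [DecidableEq b] [Fintype c]
    [DecidableEq c] (A : Matrix a b ℂ) (B : Matrix b c ℂ) (x : EuclideanSpace ℂ c) :
    Matrix.toEuclideanLin (A * B) x = Matrix.toEuclideanLin A (Matrix.toEuclideanLin B x) := by
  rw [Matrix.toLpLin_mul (q := 2), LinearMap.comp_apply]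

/-- An eigenvector of the square of a positive semidefinite matrix is an eigenvector. -/
theorem toEuclideanLin_apply_of_sq_apply {S : Matrix a a ℂ} (hS : S.PosSemidef)
    {x : EuclideanSpace ℂ a} {s : ℝ} (hs : 0 ≤ s)
    (hx : Matrix.toEuclideanLin (S * S) x = ((s ^ 2 : ℝ) : ℂ) • x) :
    Matrix.toEuclideanLin S x = (s : ℂ) • x := by
  rw [toEuclideanLin_mul_apply] at hx
  set T := Matrix.toEuclideanLin S with hT
  have hpos : ∀ y, 0 ≤ (inner ℂ y (T y)).re := fun y => by
    have h := hS.dotProduct_mulVec_nonneg y.ofLp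
    have h1 : inner ℂ y (T y) = star y.ofLp ⬝ᵥ S *ᵥ y.ofLp := by
      rw [EuclideanSpace.inner_eq_star_dotProduct, dotProduct_comm]
      rfl
    rw [h1]
    exact (Complex.le_def.1 h).1
  -- Then `T w = -s w`, and positivity of `T` forces `s ‖w‖² ≤ 0`.
  set w := T x - (s : ℂ) • x with hw
  have hTw : T w = -((s : ℂ) • w) := by
    rw [hw, map_sub, map_smul, hx, smul_sub, smul_smul]
    push_cast
    rw [pow_two]
    abel
  have h0 : s * ‖w‖ ^ 2 ≤ 0 := by
    have h := hpos w
    rw [hTw, inner_neg_right, inner_smul_right, inner_self_eq_norm_sq_to_K] at h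
    have h2 : (-((s : ℂ) * ((‖w‖ : ℂ)) ^ 2)).re = -(s * ‖w‖ ^ 2) := by
      rw [← Complex.ofReal_pow, ← Complex.ofReal_mul, ← Complex.ofReal_neg, Complex.ofReal_re]
    have h3 := h.trans_eq h2
    linarith
  rcases hs.eq_or_lt with rfl | hs
  · have h1 : inner ℂ (T x) (T x) = 0 := by
      rw [hT, inner_toEuclideanLin_right, hS.isHermitian.eq, ← hT, hx]
      simp
    rw [inner_self_eq_zero.1 h1]
    simp
  · have : ‖w‖ ^ 2 ≤ 0 := by nlinarith
    have hw0 : w = 0 := norm_eq_zero.1 (pow_eq_zero_iff two_ne_zero |>.1 (le_antisymm this (sq_nonneg _)))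
    exact sub_eq_zero.1 hw0

/-- Polar decomposition with a contraction in place of a partial isometry. -/
theorem exists_cfcSqrt_mul_eq (M : Matrix a b ℂ) :
    ∃ V : Matrix a b ℂ, ‖V‖ ≤ 1 ∧ CFC.sqrt (M * Mᴴ) * V = M := by
  obtain ⟨v, -, horth⟩ := exists_singular_basis Mᴴ
  obtain ⟨W, hW, -, hWi⟩ := exists_contraction_apply_eq (fun i j hij => horth i j hij) v
  have hS := posSemidef_cfcSqrt (M * Mᴴ)
  have hSS := cfcSqrt_mul_conjTranspose M
  generalize CFC.sqrt (M * Mᴴ) = S at hS hSS ⊢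
  have hρ : ∀ i, Matrix.toEuclideanLin (M * Mᴴ) (v i) =
      ((‖Matrix.toEuclideanLin Mᴴ (v i)‖ ^ 2 : ℝ) : ℂ) • v i := fun i => by
    refine InnerProductSpace.ext_inner_left_basis v.toBasis fun j => ?_
    rw [OrthonormalBasis.coe_toBasis, toEuclideanLin_mul_apply, inner_toEuclideanLin_right,
      inner_smul_right]
    rcases eq_or_ne j i with rfl | hij
    · rw [inner_self_eq_norm_sq_to_K, inner_self_eq_norm_sq_to_K, v.norm_eq_one]
      simp
    · rw [horth j i hij, v.inner_eq_zero hij, mul_zero]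
  refine ⟨Matrix.toEuclideanLin.symm W, l2_opNorm_le_of_forall_le zero_le_one fun x => ?_, ?_⟩
  · rw [LinearEquiv.apply_symm_apply, one_mul]
    exact hW x
  · refine Matrix.toEuclideanLin.injective (LinearMap.ext fun x => ?_)
    -- With `S vᵢ = ‖Mᴴ vᵢ‖ vᵢ`, pairing `S W x` with `vᵢ` gives `⟨Mᴴ vᵢ, x⟩`, also when the
    -- singular value is zero.
    refine InnerProductSpace.ext_inner_left_basis v.toBasis fun i => ?_
    rw [OrthonormalBasis.coe_toBasis, toEuclideanLin_mul_apply, inner_toEuclideanLin_right S,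
      inner_toEuclideanLin_right M, hS.isHermitian.eq,
      toEuclideanLin_apply_of_sq_apply hS (norm_nonneg _) ((congrArg (fun A =>
        Matrix.toEuclideanLin A (v i)) hSS).trans (hρ i)),
      LinearEquiv.apply_symm_apply, inner_smul_left, Complex.conj_ofReal, hWi]

end Polar

end AcidNorm

namespace AcidNorm

open scoped Matrix.Norms.L2Operator ComplexOrder

/-! ### Vectorization -/

section Vectorization

variable {a b : Type*} [Fintype a] [Fintype b]

/-- The vectorization of a matrix. -/
noncomputable def vectorize (N : Matrix a b ℂ) : EuclideanSpace ℂ (a × b) :=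
  WithLp.toLp 2 fun p => N p.1 p.2

/-- The operator `|x⟩⟨y|`. -/
noncomputable def ketBra (x y : EuclideanSpace ℂ a) : Matrix a a ℂ :=
  Matrix.vecMulVec x.ofLp (star y.ofLp)

theorem inner_vectorize (A B : Matrix a b ℂ) :
    inner ℂ (vectorize A) (vectorize B) = (Aᴴ * B).trace := by
  rw [Matrix.trace_mul_comm, EuclideanSpace.inner_eq_star_dotProduct]
  simp [vectorize, dotProduct, Matrix.trace, Matrix.mul_apply, Fintype.sum_prod_type]

variable [DecidableEq b]

theorem l2_opNorm_le_norm_vectorize (N : Matrix a b ℂ) : ‖N‖ ≤ ‖vectorize N‖ := by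
  refine l2_opNorm_le_of_forall_le (norm_nonneg _) fun x => le_of_sq_le_sq ?_ (by positivity)
  have h1 : ‖vectorize N‖ ^ 2 =
      ∑ i, ‖(WithLp.toLp 2 (star (N i)) : EuclideanSpace ℂ b)‖ ^ 2 := by
    simp [EuclideanSpace.norm_sq_eq, Fintype.sum_prod_type, vectorize]
  rw [mul_pow, h1, Finset.sum_mul, EuclideanSpace.norm_sq_eq]
  refine Finset.sum_le_sum fun i _ => ?_
  rw [← mul_pow]
  have h2 : (Matrix.toEuclideanLin N x) i =
      inner ℂ (WithLp.toLp 2 (star (N i)) : EuclideanSpace ℂ b) x := by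
    simp [EuclideanSpace.inner_eq_star_dotProduct, Matrix.toLpLin_apply, Matrix.mulVec,
      dotProduct_comm]
  rw [h2]
  gcongr
  exact norm_inner_le_norm _ _

variable [DecidableEq a]

theorem l2_opNorm_transpose_le (U : Matrix a b ℂ) : ‖Uᵀ‖ ≤ ‖U‖ := by
  rw [← Matrix.l2_opNorm_conjTranspose]
  refine l2_opNorm_le_of_forall_le (norm_nonneg _) fun x => ?_
  have h1 : Matrix.toEuclideanLin Uᵀᴴ x = WithLp.toLp 2 (star
      (Matrix.toEuclideanLin U (WithLp.toLp 2 (star x.ofLp))).ofLp) := by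
    ext i
    simp [Matrix.toLpLin_apply, Matrix.mulVec, dotProduct]
  rw [h1, EuclideanSpace.norm_eq]
  refine le_trans (le_of_eq ?_) ((norm_toEuclideanLin_le U (WithLp.toLp 2 (star x.ofLp))).trans
    (le_of_eq ?_))
  · simp [EuclideanSpace.norm_eq]
  · simp [EuclideanSpace.norm_eq]

theorem l2_opNorm_one_kronecker_le (C : Matrix b b ℂ) : ‖(1 : Matrix a a ℂ) ⊗ₖ C‖ ≤ ‖C‖ := by
  refine l2_opNorm_le_of_forall_le (norm_nonneg _) fun x => le_of_sq_le_sq ?_ (by positivity)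
  let y : a → EuclideanSpace ℂ b := fun i => WithLp.toLp 2 fun p => x (i, p)
  have h1 : ‖Matrix.toEuclideanLin ((1 : Matrix a a ℂ) ⊗ₖ C) x‖ ^ 2 =
      ∑ i, ‖Matrix.toEuclideanLin C (y i)‖ ^ 2 := by
    simp only [EuclideanSpace.norm_sq_eq, Fintype.sum_prod_type]
    refine Finset.sum_congr rfl fun i _ => Finset.sum_congr rfl fun p _ => ?_
    congr 2
    simp [Matrix.toLpLin_apply, Matrix.mulVec, dotProduct, Fintype.sum_prod_type,
      Matrix.one_apply, y, Finset.sum_ite_eq]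
  have h2 : ‖x‖ ^ 2 = ∑ i, ‖y i‖ ^ 2 := by
    simp only [EuclideanSpace.norm_sq_eq, Fintype.sum_prod_type, y]
  rw [h1, mul_pow, h2, Finset.mul_sum]
  refine Finset.sum_le_sum fun i _ => ?_
  rw [← mul_pow]
  gcongr
  exact norm_toEuclideanLin_le _ _

theorem vectorize_mul (N : Matrix a b ℂ) (U : Matrix b b ℂ) :
    vectorize (N * U) = Matrix.toEuclideanLin ((1 : Matrix a a ℂ) ⊗ₖ Uᵀ) (vectorize N) := by
  ext ⟨i, p⟩
  simp [vectorize, Matrix.toLpLin_apply, Matrix.mulVec, dotProduct, Fintype.sum_prod_type,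
    Matrix.one_apply, Matrix.mul_apply, mul_comm]

theorem ketBra_toEuclideanLin (T S : Matrix a a ℂ) (x y : EuclideanSpace ℂ a) :
    ketBra (Matrix.toEuclideanLin T x) (Matrix.toEuclideanLin S y) = T * ketBra x y * Sᴴ := by
  simp only [ketBra, Matrix.toLpLin_apply, Matrix.star_mulVec, Matrix.mul_vecMulVec,
    Matrix.vecMulVec_mul]

theorem traceNorm_ketBra_le (x y : EuclideanSpace ℂ a) : traceNorm (ketBra x y) ≤ ‖x‖ * ‖y‖ :=
  traceNorm_vecMulVec_le x y

theorem traceNorm_ketBra_sub_ketBra_le (x y : EuclideanSpace ℂ a) :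
    traceNorm (ketBra x x - ketBra y y) ≤ (‖x‖ + ‖y‖) * ‖x - y‖ := by
  have h : ketBra x x - ketBra y y = ketBra x (x - y) + ketBra (x - y) y := by
    simp only [ketBra, WithLp.ofLp_sub, star_sub, Matrix.vecMulVec_sub, Matrix.sub_vecMulVec]
    abel
  rw [h]
  refine (traceNorm_add_le _ _).trans ((add_le_add (traceNorm_ketBra_le _ _)
    (traceNorm_ketBra_le _ _)).trans (le_of_eq (by ring)))

end Vectorization

/-! ### Norms of superoperators -/

section Superoperator

variable {d k : ℕ}

theorem kronecker_conj_apply {n r : ℕ} (C D : Matrix (Fin r) (Fin r) ℂ)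
    (Y : Matrix (Fin n × Fin r) (Fin n × Fin r) ℂ) (i j : Fin n) (p q : Fin r) :
    (((1 : Matrix (Fin n) (Fin n) ℂ) ⊗ₖ C) * Y * ((1 : Matrix (Fin n) (Fin n) ℂ) ⊗ₖ D)) (i, p) (j, q) =
      ∑ s, ∑ t, (C p s * D t q) * Y (i, s) (j, t) := by
  simp only [Matrix.mul_apply, Fintype.sum_prod_type, Matrix.kroneckerMap_apply, Matrix.one_apply,
    ite_mul, mul_ite, one_mul, zero_mul, mul_zero, Finset.sum_ite_irrel, Finset.sum_const_zero,
    Finset.sum_ite_eq, Finset.sum_ite_eq', Finset.mem_univ, if_true, Finset.sum_mul]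
  rw [Finset.sum_comm]
  refine Finset.sum_congr rfl fun s _ => Finset.sum_congr rfl fun t _ => by ring

theorem ampliation_kronecker_conj (L : Superoperator d k) {r : ℕ} (C D : Matrix (Fin r) (Fin r) ℂ)
    (X : Matrix (Fin d × Fin r) (Fin d × Fin r) ℂ) :
    ampliation r L (((1 : Matrix (Fin d) (Fin d) ℂ) ⊗ₖ C) * X *
        ((1 : Matrix (Fin d) (Fin d) ℂ) ⊗ₖ D)) =
      ((1 : Matrix (Fin k) (Fin k) ℂ) ⊗ₖ C) * ampliation r L X *
        ((1 : Matrix (Fin k) (Fin k) ℂ) ⊗ₖ D) := by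
  ext ⟨i, p⟩ ⟨j, q⟩
  rw [kronecker_conj_apply]
  have h : (Matrix.of fun i j => (((1 : Matrix (Fin d) (Fin d) ℂ) ⊗ₖ C) * X *
      ((1 : Matrix (Fin d) (Fin d) ℂ) ⊗ₖ D)) (i, p) (j, q)) =
      ∑ s, ∑ t, (C p s * D t q) • (Matrix.of fun i j => X (i, s) (j, t)) := by
    ext i j
    simp [kronecker_conj_apply, Matrix.sum_apply]
  change L (Matrix.of fun i j => (((1 : Matrix (Fin d) (Fin d) ℂ) ⊗ₖ C) * X *
      ((1 : Matrix (Fin d) (Fin d) ℂ) ⊗ₖ D)) (i, p) (j, q)) i j = _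
  rw [h]
  simp only [map_sum, map_smul, Matrix.sum_apply, Matrix.smul_apply, smul_eq_mul]
  rfl

/-- Right multiplication of a coefficient matrix is `1 ⊗ Uᵀ` on its vectorization, and operators on
the second register pass through `L ⊗ I`. -/
theorem traceNorm_ampliation_ketBra_mul_le (L : Superoperator d k)
    (N N' U U' : Matrix (Fin d) (Fin d) ℂ) :
    traceNorm (ampliation d L (ketBra (vectorize (N * U)) (vectorize (N' * U')))) ≤
      ‖U‖ * ‖U'‖ * traceNorm (ampliation d L (ketBra (vectorize N) (vectorize N'))) := by
  rw [vectorize_mul, vectorize_mul, ketBra_toEuclideanLin, Matrix.conjTranspose_kronecker,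
    Matrix.conjTranspose_one, ampliation_kronecker_conj]
  refine (traceNorm_mul_mul_le _ _ _).trans ?_
  have h1 : ‖(1 : Matrix (Fin k) (Fin k) ℂ) ⊗ₖ Uᵀ‖ ≤ ‖U‖ :=
    (l2_opNorm_one_kronecker_le _).trans (l2_opNorm_transpose_le U)
  have h2 : ‖(1 : Matrix (Fin k) (Fin k) ℂ) ⊗ₖ U'ᵀᴴ‖ ≤ ‖U'‖ :=
    (l2_opNorm_one_kronecker_le _).trans
      ((Matrix.l2_opNorm_conjTranspose U'ᵀ).le.trans (l2_opNorm_transpose_le U'))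
  exact mul_le_mul_of_nonneg_right (mul_le_mul h1 h2 (norm_nonneg _) (norm_nonneg _))
    (traceNorm_nonneg _)

theorem unnormMaxEnt_eq_ketBra :
    unnormMaxEnt d = ketBra (vectorize (1 : Matrix (Fin d) (Fin d) ℂ)) (vectorize 1) := by
  ext ⟨i, s⟩ ⟨j, t⟩
  by_cases h1 : i = s <;> by_cases h2 : j = t <;>
    simp [unnormMaxEnt, ketBra, vectorize, Matrix.vecMulVec_apply, Matrix.one_apply, h1, h2]

theorem traceNorm_ampliation_unnormMaxEnt (hd : d ≠ 0) (L : Superoperator d k) :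
    traceNorm (ampliation d L (unnormMaxEnt d)) = d * acidNorm L := by
  rw [acidNorm, maxEnt, map_smul, traceNorm_smul, norm_inv, Complex.norm_natCast]
  field_simp

/-- Each rank-one operator arises from `Ψ` by matrices on the second register, whose operator norms
are at most the Hilbert–Schmidt norms `‖x‖` and `‖y‖`. -/
theorem traceNorm_ampliation_le (hd : d ≠ 0) (L : Superoperator d k)
    (X : Matrix (Fin d × Fin d) (Fin d × Fin d) ℂ) :
    traceNorm (ampliation d L X) ≤ d * acidNorm L * traceNorm X := by
  refine traceNorm_map_le_of_rank_one _ (fun x y => ?_) X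
  set N : Matrix (Fin d) (Fin d) ℂ := Matrix.of fun i s => x (i, s) with hN
  set N' : Matrix (Fin d) (Fin d) ℂ := Matrix.of fun i s => y (i, s) with hN'
  have hx : x = vectorize (1 * N) := by rw [one_mul]; rfl
  have hy : y = vectorize (1 * N') := by rw [one_mul]; rfl
  have h := traceNorm_ampliation_ketBra_mul_le L 1 1 N N'
  rw [← hx, ← hy, ← unnormMaxEnt_eq_ketBra, traceNorm_ampliation_unnormMaxEnt hd] at h
  refine h.trans ?_
  have h1 : ‖N‖ ≤ ‖x‖ := by
    conv_rhs => rw [hx, one_mul]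
    exact l2_opNorm_le_norm_vectorize N
  have h2 : ‖N'‖ ≤ ‖y‖ := by
    conv_rhs => rw [hy, one_mul]
    exact l2_opNorm_le_norm_vectorize N'
  have h3 : 0 ≤ (d : ℝ) * acidNorm L := mul_nonneg (Nat.cast_nonneg _) (traceNorm_nonneg _)
  rw [mul_comm]
  exact mul_le_mul_of_nonneg_left (mul_le_mul h1 h2 (norm_nonneg _) (norm_nonneg _)) h3

theorem bddAbove_diamond (hd : d ≠ 0) (L : Superoperator d k) :
    BddAbove {r : ℝ | ∃ X : Matrix (Fin d × Fin d) (Fin d × Fin d) ℂ,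
      traceNorm X = 1 ∧ r = traceNorm (ampliation d L X)} := by
  refine ⟨d * acidNorm L, ?_⟩
  rintro _ ⟨X, hX, rfl⟩
  simpa [hX] using traceNorm_ampliation_le hd L X

theorem acidNorm_nonneg (L : Superoperator d k) : 0 ≤ acidNorm L := traceNorm_nonneg _

theorem diamondNorm_le (hd : d ≠ 0) (L : Superoperator d k) :
    diamondNorm L ≤ d * acidNorm L := by
  refine Real.sSup_le ?_ (mul_nonneg (Nat.cast_nonneg _) (acidNorm_nonneg L))
  rintro _ ⟨X, hX, rfl⟩
  simpa [hX] using traceNorm_ampliation_le hd L X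

theorem traceNorm_ampliation_le_diamondNorm (hd : d ≠ 0) (L : Superoperator d k)
    (X : Matrix (Fin d × Fin d) (Fin d × Fin d) ℂ) :
    traceNorm (ampliation d L X) ≤ diamondNorm L * traceNorm X := by
  rcases (traceNorm_nonneg X).eq_or_lt with h | h
  · rw [traceNorm_eq_zero h.symm, map_zero, traceNorm_zero, traceNorm_zero, mul_zero]
  · have hnorm : ‖((traceNorm X)⁻¹ : ℂ)‖ = (traceNorm X)⁻¹ := by
      rw [norm_inv, Complex.norm_real, Real.norm_of_nonneg h.le]
    have h1 := le_csSup (bddAbove_diamond hd L) ⟨((traceNorm X)⁻¹ : ℂ) • X, by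
      rw [traceNorm_smul, hnorm, inv_mul_cancel₀ h.ne'], rfl⟩
    rw [map_smul, traceNorm_smul, hnorm, inv_mul_le_iff₀ h, mul_comm] at h1
    exact h1

theorem acidNorm_pos {L : Superoperator d k} (hd : d ≠ 0) (hL : L ≠ 0) : 0 < acidNorm L := by
  refine lt_of_le_of_ne (acidNorm_nonneg L) fun h => hL ?_
  have h0 : ∀ X, ampliation d L X = 0 := fun X => traceNorm_eq_zero (le_antisymm (by
    simpa [← h] using traceNorm_ampliation_le hd L X) (traceNorm_nonneg _))
  refine LinearMap.ext fun A => ?_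
  have h1 := h0 (A ⊗ₖ 1)
  rw [ampliation_kronecker] at h1
  ext i j
  have h2 := congrFun (congrFun h1 (i, ⟨0, Nat.pos_of_ne_zero hd⟩)) (j, ⟨0, Nat.pos_of_ne_zero hd⟩)
  simpa using h2

theorem diamondNorm_pos {L : Superoperator d k} (hd : d ≠ 0) (hL : L ≠ 0) : 0 < diamondNorm L := by
  have h := traceNorm_ampliation_le_diamondNorm hd L (maxEnt d)
  have h1 : 0 < diamondNorm L * traceNorm (maxEnt d) := (acidNorm_pos hd hL).trans_le h
  exact pos_of_mul_pos_left h1 (traceNorm_nonneg _)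

end Superoperator

end AcidNorm

namespace AcidNorm

/-! ### Lipschitz continuity of the `ρ` norm -/

section RhoNorm

variable {d m k : ℕ}

theorem sqrt_kronecker_mul_unnormMaxEnt (ρ : Matrix (Fin d) (Fin d) ℂ) :
    (CFC.sqrt ρ ⊗ₖ (1 : Matrix (Fin d) (Fin d) ℂ)) * unnormMaxEnt d *
      (CFC.sqrt ρ ⊗ₖ (1 : Matrix (Fin d) (Fin d) ℂ)) =
      ketBra (vectorize (CFC.sqrt ρ)) (vectorize (CFC.sqrt ρ)) := by
  have hH := isHermitian_cfcSqrt ρ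
  generalize CFC.sqrt ρ = S at hH ⊢
  have h1 : vectorize S = Matrix.toEuclideanLin (S ⊗ₖ (1 : Matrix (Fin d) (Fin d) ℂ))
      (vectorize 1) := by
    ext ⟨i, p⟩
    simp [vectorize, Matrix.toLpLin_apply, Matrix.mulVec, dotProduct, Fintype.sum_prod_type,
      Matrix.one_apply]
  rw [h1, ketBra_toEuclideanLin, ← unnormMaxEnt_eq_ketBra, Matrix.conjTranspose_kronecker,
    Matrix.conjTranspose_one, hH.eq]

/-- The matrix of coefficients of a bipartite state vector. -/
noncomputable def coeffMatrix (ψ : StateVector d m) : Matrix (Fin d) (Fin m) ℂ :=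
  Matrix.of fun i s => ψ.1 (i, s)

theorem vectorize_coeffMatrix (ψ : StateVector d m) : vectorize (coeffMatrix ψ) = ψ.1 := rfl

theorem reducedState_eq (ψ : StateVector d m) :
    reducedState ψ = coeffMatrix ψ * (coeffMatrix ψ)ᴴ := by
  ext i j
  simp [reducedState, partialTrace, pureState, coeffMatrix, Matrix.mul_apply]

theorem rhoNorm_eq (ρ : Matrix (Fin d) (Fin d) ℂ) (L : Superoperator d k) :
    rhoNorm ρ L =
      traceNorm (ampliation d L (ketBra (vectorize (CFC.sqrt ρ)) (vectorize (CFC.sqrt ρ)))) := by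
  rw [rhoNorm, sqrt_kronecker_mul_unnormMaxEnt]

open scoped Matrix.Norms.L2Operator

theorem norm_vectorize_mul_le {a b : Type*} [Fintype a] [DecidableEq a] [Fintype b] [DecidableEq b]
    (N : Matrix a b ℂ) {U : Matrix b b ℂ} (hU : ‖U‖ ≤ 1) :
    ‖vectorize (N * U)‖ ≤ ‖vectorize N‖ := by
  rw [vectorize_mul]
  refine (norm_toEuclideanLin_le _ _).trans (mul_le_of_le_one_left (norm_nonneg _) ?_)
  exact (l2_opNorm_one_kronecker_le _).trans ((l2_opNorm_transpose_le U).trans hU)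

/-- The easy half of Uhlmann's theorem: with polar factors `M = S V` and `N = R W`, the contraction
`U = W Vᴴ` makes the overlap of `S` and `R U` equal to that of the states. Since `‖vec (R U)‖ ≤ 1`,
the distance does not grow. -/
theorem exists_contraction_norm_vectorize_sub_le (ψ φ : StateVector d m) :
    ∃ U : Matrix (Fin d) (Fin d) ℂ, ‖U‖ ≤ 1 ∧ ‖vectorize (CFC.sqrt (reducedState ψ))‖ = 1 ∧
      ‖vectorize (CFC.sqrt (reducedState φ) * U)‖ ≤ 1 ∧
      ‖vectorize (CFC.sqrt (reducedState ψ)) - vectorize (CFC.sqrt (reducedState φ) * U)‖ ≤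
        ‖ψ.1 - φ.1‖ := by
  rw [reducedState_eq, reducedState_eq]
  have hψ : ‖vectorize (coeffMatrix ψ)‖ = 1 := by rw [vectorize_coeffMatrix]; simp
  have hφ : ‖vectorize (coeffMatrix φ)‖ = 1 := by rw [vectorize_coeffMatrix]; simp
  rw [← vectorize_coeffMatrix, ← vectorize_coeffMatrix]
  generalize coeffMatrix ψ = M at *
  generalize coeffMatrix φ = N at *
  obtain ⟨V, hV, hMV⟩ := exists_cfcSqrt_mul_eq M
  obtain ⟨W, hW, hNW⟩ := exists_cfcSqrt_mul_eq N
  have hHM := isHermitian_cfcSqrt (M * Mᴴ)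
  have hHN := isHermitian_cfcSqrt (N * Nᴴ)
  have hSM := cfcSqrt_mul_conjTranspose M
  have hSN := cfcSqrt_mul_conjTranspose N
  generalize CFC.sqrt (M * Mᴴ) = S at *
  generalize CFC.sqrt (N * Nᴴ) = R at *
  have hnorm : ∀ {S : Matrix (Fin d) (Fin d) ℂ} {M : Matrix (Fin d) (Fin m) ℂ},
      S.IsHermitian → S * S = M * Mᴴ → ‖vectorize M‖ = 1 → ‖vectorize S‖ = 1 := by
    intro S M hS hSM hM
    have h1 : (‖vectorize S‖ : ℂ) ^ 2 = (‖vectorize M‖ : ℂ) ^ 2 := by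
      have h2 := inner_self_eq_norm_sq_to_K (𝕜 := ℂ) (vectorize S)
      have h3 := inner_self_eq_norm_sq_to_K (𝕜 := ℂ) (vectorize M)
      rw [inner_vectorize, hS.eq, hSM] at h2
      rw [inner_vectorize, Matrix.trace_mul_comm] at h3
      exact h2.symm.trans h3
    have h4 : ‖vectorize S‖ ^ 2 = ‖vectorize M‖ ^ 2 := by exact_mod_cast h1
    rw [hM] at h4
    exact (sq_eq_sq₀ (norm_nonneg _) zero_le_one).1 h4
  have hU : ‖W * Vᴴ‖ ≤ 1 := (Matrix.l2_opNorm_mul _ _).trans (by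
    rw [Matrix.l2_opNorm_conjTranspose]
    exact mul_le_one₀ hW (norm_nonneg _) hV)
  have hS1 := hnorm hHM hSM hψ
  have hR1 := (norm_vectorize_mul_le R hU).trans (hnorm hHN hSN hφ).le
  refine ⟨W * Vᴴ, hU, hS1, hR1, le_of_sq_le_sq ?_ (norm_nonneg _)⟩
  have hinner : inner ℂ (vectorize S) (vectorize (R * (W * Vᴴ))) =
      inner ℂ (vectorize M) (vectorize N) := by
    rw [inner_vectorize, inner_vectorize, ← hMV, ← hNW, Matrix.conjTranspose_mul, hHM.eq,
      ← Matrix.mul_assoc R, ← Matrix.mul_assoc S, Matrix.trace_mul_comm, Matrix.mul_assoc]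
  rw [@norm_sub_sq ℂ, @norm_sub_sq ℂ, hinner, hS1, hψ, hφ]
  have : ‖vectorize (R * (W * Vᴴ))‖ ^ 2 ≤ 1 ^ 2 := by gcongr
  linarith

/-- The triangle inequality passes through `vec (R U)`: dropping `U` only raises the first term, and
the diamond norm controls the rest. -/
theorem rhoNorm_reducedState_le (hd : d ≠ 0) (L : Superoperator d k) (hL : L ≠ 0)
    (ψ φ : StateVector d m) :
    rhoNorm (reducedState ψ) L ≤
      rhoNorm (reducedState φ) L + 2 * diamondNorm L * ‖ψ.1 - φ.1‖ := by
  obtain ⟨U, hU, hS1, hR1, hdist⟩ := exists_contraction_norm_vectorize_sub_le ψ φ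
  rw [rhoNorm_eq, rhoNorm_eq]
  generalize CFC.sqrt (reducedState ψ) = S at *
  generalize CFC.sqrt (reducedState φ) = R at *
  have hD := diamondNorm_pos hd hL
  set x := vectorize S
  set y := vectorize (R * U) with hy
  have h1 : ampliation d L (ketBra x x) =
      ampliation d L (ketBra y y) + ampliation d L (ketBra x x - ketBra y y) := by
    rw [← map_add, add_sub_cancel]
  rw [h1]
  refine (traceNorm_add_le _ _).trans (add_le_add ?_ ?_)
  · refine (traceNorm_ampliation_ketBra_mul_le L R R U U).trans ?_
    exact mul_le_of_le_one_left (traceNorm_nonneg _) (mul_le_one₀ hU (norm_nonneg _) hU)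
  · refine (traceNorm_ampliation_le_diamondNorm hd L _).trans ?_
    rw [mul_comm 2, mul_assoc]
    refine mul_le_mul_of_nonneg_left ((traceNorm_ketBra_sub_ketBra_le x y).trans ?_) hD.le
    exact mul_le_mul (by linarith) hdist (norm_nonneg _) zero_le_two

theorem lipschitzWith_rhoNorm_reducedState (hd : d ≠ 0) (L : Superoperator d k) (hL : L ≠ 0) :
    LipschitzWith (2 * diamondNorm L).toNNReal
      (fun ψ : StateVector d m => rhoNorm (reducedState ψ) L) := by
  refine LipschitzWith.of_le_add_mul _ fun ψ φ => ?_
  rw [Real.coe_toNNReal _ (by linarith [diamondNorm_pos hd hL]), Subtype.dist_eq, dist_eq_norm]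
  exact rhoNorm_reducedState_le hd L hL ψ φ

end RhoNorm

/-! ### The concentration theorem -/

theorem finrank_stateSpace (d m : ℕ) :
    Module.finrank ℝ (EuclideanSpace ℂ (Fin d × Fin m)) = 2 * (d * m) := by
  rw [← Module.finrank_mul_finrank ℝ ℂ, Complex.finrank_real_complex, finrank_euclideanSpace]
  simp

end AcidNorm

theorem theorem5p10 {Ω : Type*} [MeasurableSpace Ω] (P : Measure Ω) [IsProbabilityMeasure P]
    {d m k : ℕ} (ψ : Ω → AcidNorm.StateVector d m)
    (hψ : HasLaw ψ (AcidNorm.haarState d m) P)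
    (ρ : Ω → Matrix (Fin d) (Fin d) ℂ) (hρ : ∀ ω, ρ ω = AcidNorm.reducedState (ψ ω))
    (L : AcidNorm.Superoperator d k) (hL : L ≠ 0) (t : ℝ) (ht : 0 ≤ t) :
    Integrable (fun ω => AcidNorm.rhoNorm (ρ ω) L) P ∧
    P.real {ω | t * AcidNorm.acidNorm L ≤
        |AcidNorm.rhoNorm (ρ ω) L - ∫ ω', AcidNorm.rhoNorm (ρ ω') L ∂P|} ≤
      Real.exp (Real.pi -
        d * m * t ^ 2 * AcidNorm.acidNorm L ^ 2 / (8 * AcidNorm.diamondNorm L ^ 2)) ∧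
    Real.exp (Real.pi -
        d * m * t ^ 2 * AcidNorm.acidNorm L ^ 2 / (8 * AcidNorm.diamondNorm L ^ 2)) ≤
      Real.exp (Real.pi - m * t ^ 2 / (8 * d)) := by
  have hd : d ≠ 0 := by
    rintro rfl
    exact hL (LinearMap.ext fun A => by rw [Subsingleton.elim A 0, map_zero, map_zero])
  have hA := AcidNorm.acidNorm_pos hd hL
  have hD := AcidNorm.diamondNorm_pos hd hL
  obtain ⟨ω₀⟩ : Nonempty Ω := nonempty_of_isProbabilityMeasure P
  have : Nontrivial (EuclideanSpace ℂ (Fin d × Fin m)) :=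
    ⟨(ψ ω₀ : EuclideanSpace ℂ (Fin d × Fin m)), 0, ne_zero_of_mem_unit_sphere (ψ ω₀)⟩
  have hlaw : HasLaw ψ (AcidNorm.uniformSphere (EuclideanSpace ℂ (Fin d × Fin m))) P := hψ
  have hprob := AcidNorm.isProbabilityMeasure_uniformSphere
    (E := EuclideanSpace ℂ (Fin d × Fin m))
  set f : AcidNorm.StateVector d m → ℝ := fun φ => AcidNorm.rhoNorm (AcidNorm.reducedState φ) L
    with hf_def
  have hf := AcidNorm.lipschitzWith_rhoNorm_reducedState (m := m) hd L hL
  have hK : (0 : ℝ) < 2 * AcidNorm.diamondNorm L := by linarith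
  have hfc : Continuous f := hf.continuous
  have hfi : Integrable f (AcidNorm.uniformSphere (EuclideanSpace ℂ (Fin d × Fin m))) :=
    hfc.integrable_of_hasCompactSupport (HasCompactSupport.of_compactSpace f)
  simp only [hρ]
  refine ⟨(hlaw.map_eq ▸ hfi : Integrable f (P.map ψ)).comp_aemeasurable hlaw.aemeasurable, ?_, Real.exp_le_exp.2 ?_⟩
  -- With dimension `2dm` and `K = 2‖L‖_⋄`, the exponent `n s² / (4 K²)` is `d m s² / (8 ‖L‖_⋄²)`.
  · have h := AcidNorm.measureReal_uniformSphere_abs_sub_integral_ge_le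
      (Real.toNNReal_pos.2 hK) hf (s := t * AcidNorm.acidNorm L) (mul_nonneg ht hA.le)
    rw [Real.coe_toNNReal _ hK.le, AcidNorm.finrank_stateSpace] at h
    have hint := hlaw.integral_comp (f := f) hfi.aestronglyMeasurable
    have hset : MeasurableSet {φ : AcidNorm.StateVector d m | t * AcidNorm.acidNorm L ≤
        |f φ - ∫ ω, (f ∘ ψ) ω ∂P|} :=
      measurableSet_le measurable_const (by fun_prop)
    rw [← hint, ← hlaw.map_eq, map_measureReal_apply_of_aemeasurable hlaw.aemeasurable hset] at h
    refine h.trans (le_of_eq ?_)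
    congr 2
    push_cast
    field_simp
    ring
  · have hDA := AcidNorm.diamondNorm_le hd L
    have hd' : (0 : ℝ) < d := by exact_mod_cast Nat.pos_of_ne_zero hd
    have h1 : m * t ^ 2 / (8 * d) ≤
        d * m * t ^ 2 * AcidNorm.acidNorm L ^ 2 / (8 * AcidNorm.diamondNorm L ^ 2) := by
      rw [div_le_div_iff₀ (by positivity) (by positivity)]
      have h2 : AcidNorm.diamondNorm L ^ 2 ≤ (d * AcidNorm.acidNorm L) ^ 2 := by gcongr
      calc m * t ^ 2 * (8 * AcidNorm.diamondNorm L ^ 2)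
          ≤ m * t ^ 2 * (8 * (d * AcidNorm.acidNorm L) ^ 2) := by gcongr
        _ = _ := by ring
    linarith
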